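/- Let $(M_p)_{p\in\mathbb N}$ be a sequence of positive numbers with $M_0=1$ satisfying $(M.1)$ $M_p^2\le M_{p-1}M_{p+1}$ for $p\ge 1$; $(M.2)$ $M_p\le c_0H^p\min_{0\le q\le p}M_{p-q}M_q$ for $p\in\mathbb N$; $(M.3)$ $\sum_{p=q+1}^\infty M_{p-1}/M_p\le c_0\,q\,M_q/M_{q+1}$ for $q\ge 1$, for some constants $c_0,H\ge 1$. For $\alpha\in\mathbb N^d$ put $M_\alpha=M_{|\alpha|}$ and $D^\alpha=i^{-|\alpha|}\partial^\alpha$. Let $\mathfrak R$ be the set of all sequences $(t_j)_{j\ge1}$ of positive numbers that increase monotonically to infinity, and put $T_\alpha=\prod_{j=1}^{|\alpha|}t_j$. Let $\mathcal D^{\{M_p\}}$ be the space of all compactly supported $\varphi\in C^\infty(\mathbb R^d)$ for which there are $h,C>0$ with $|D^\alpha\varphi(x)|\le Ch^{|\alpha|}M_\alpha$ for all $\alpha\in\mathbb N^d$, $x\in\mathbb R^d$. Let $\tilde{\mathcal D}^{\{M_p\}}_{L^\infty}$ be the space of all $\varphi\in C^\infty(\mathbb R^d)$ for which $$\|\varphi\|_{(t_j)}=\sup_{\alpha\in\mathbb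 N^d}\sup_{x\in\mathbb R^d}\frac{|D^\alpha\varphi(x)|}{T_\alpha M_\alpha}$$ is finite for every $(t_j)\in\mathfrak R$, with the locally convex topology given by these norms, and let $\dot{\tilde{\mathcal B}}^{\{M_p\}}$ be the completion of $\mathcal D^{\{M_p\}}$ in it, i.e. the closure of $\mathcal D^{\{M_p\}}$ in the complete space $\tilde{\mathcal D}^{\{M_p\}}_{L^\infty}$, with the induced topology. Let $\tilde{\mathcal D}'^{\{M_p\}}_{L^1}$ be the strong dual of $\dot{\tilde{\mathcal B}}^{\{M_p\}}$. Let $\tilde{\tilde{\mathcal D}}^{\{M_p\}}_{L^\infty}$ be the vector space $\tilde{\mathcal D}^{\{M_p\}}_{L^\infty}$ with the locally convex topology given by the seminorms $$p_{g,(t_j)}(\varphi)=\sup_{\alpha\in\mathbb N^d}\sup_{x\in\mathbb R^d}\frac{|g(x)D^\alpha\varphi(x)|}{T_\alpha M_\alpha},\qquad g\in\mathcal C_0(\mathbb R^d),\ (t_j)\in\mathfrak R,$$ where $\mathcal C_0(\mathbb R^d)$ is the space of continuous functions vanishing at infinity, and let $\bigl(\tilde{\tilde{\mathcal D}}^{\{M_p\}}_{L^\infty}\bigr)'$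 be its strong dual. Then the elements of each of these two duals are determined by their restrictions to $\mathcal D^{\{M_p\}}$, and, when they are identified with these restrictions, the sets $\tilde{\mathcal D}'^{\{M_p\}}_{L^1}$ and $\bigl(\tilde{\tilde{\mathcal D}}^{\{M_p\}}_{L^\infty}\bigr)'$ are equal. The inclusion $\bigl(\tilde{\tilde{\mathcal D}}^{\{M_p\}}_{L^\infty}\bigr)'\to\tilde{\mathcal D}'^{\{M_p\}}_{L^1}$, i.e. the map $T\mapsto T|_{\dot{\tilde{\mathcal B}}^{\{M_p\}}}$, is well defined, bijective and continuous for the strong topologies. -/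

import Mathlib

open scoped ContDiff Topology ZeroAtInfty

noncomputable section

namespace Roumieu

/-- The Euclidean space `ℝ^d`. -/
abbrev Rd (d : ℕ) : Type := EuclideanSpace ℝ (Fin d)

/-- A sequence `(M_p)` of positive numbers with `M_0 = 1` that satisfies the conditions
(M.1) logarithmic convexity, (M.2) stability under ultradifferential operators,
(M.3) strong non-quasianalyticity. -/
structure WeightSequence where
  /-- the underlying sequence -/
  M : ℕ → ℝ
  pos : ∀ p, 0 < M p
  zero_eq_one : M 0 = 1
  m1 : ∀ p, 1 ≤ p → M p ^ 2 ≤ M (p - 1) * M (p + 1)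
  m2 : ∃ c₀ H : ℝ, 1 ≤ c₀ ∧ 1 ≤ H ∧
    ∀ p q : ℕ, q ≤ p → M p ≤ c₀ * H ^ p * (M (p - q) * M q)
  m3 : ∃ c₀ : ℝ, 1 ≤ c₀ ∧ ∀ q : ℕ, 1 ≤ q →
    Summable (fun k : ℕ => M (q + k) / M (q + k + 1)) ∧
    ∑' k : ℕ, M (q + k) / M (q + k + 1) ≤ c₀ * q * (M q / M (q + 1))

/-- The set `ℜ` of positive sequences that increase monotonically to infinity. The value `t j`
stands for the term `t_{j+1}` of the sequence `(t_1, t_2, …)`. -/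
def IncSeq : Type :=
  {t : ℕ → ℝ // (∀ j, 0 < t j) ∧ Monotone t ∧ Filter.Tendsto t Filter.atTop Filter.atTop}

/-- The product `T_k = t_1 ⋯ t_k`, with `T_0 = 1`. -/
def IncSeq.prod (t : IncSeq) (k : ℕ) : ℝ := ∏ j ∈ Finset.range k, t.1 j

theorem IncSeq.prod_pos (t : IncSeq) (k : ℕ) : 0 < t.prod k :=
  Finset.prod_pos fun j _ => t.2.1 j

instance : Nonempty IncSeq :=
  ⟨⟨fun j => (j : ℝ) + 1, fun j => by positivity, fun a b h => by simpa using h,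
    Filter.tendsto_atTop_add_const_right _ _ tendsto_natCast_atTop_atTop⟩⟩

/-! ### Derivatives -/

/-- `D_j f = i⁻¹ ∂f/∂x_j`. -/
def D {d : ℕ} (j : Fin d) (f : Rd d → ℂ) : Rd d → ℂ :=
  fun x => Complex.I⁻¹ * fderiv ℝ f x (EuclideanSpace.single j 1)

/-- The length `|α|` of a multi-index. -/
def len {d : ℕ} (α : Fin d → ℕ) : ℕ := ∑ j, α j

/-- `D^α f = D_1^{α_1} ⋯ D_d^{α_d} f`. -/
def mD {d : ℕ} (α : Fin d → ℕ) (f : Rd d → ℂ) : Rd d → ℂ :=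
  (List.finRange d).foldr (fun j g => (D j)^[α j] g) f

section Linearity

variable {d : ℕ}

theorem D_smooth (j : Fin d) {f : Rd d → ℂ} (hf : ContDiff ℝ ∞ f) : ContDiff ℝ ∞ (D j f) :=
  contDiff_const.mul ((contDiff_infty_iff_fderiv.1 hf).2.clm_apply contDiff_const)

theorem D_add (j : Fin d) {f g : Rd d → ℂ} (hf : ContDiff ℝ ∞ f) (hg : ContDiff ℝ ∞ g) :
    D j (f + g) = D j f + D j g := by
  funext x
  have h := fderiv_add (hf.differentiable (by simp) x) (hg.differentiable (by simp) x)
  simp only [D, Pi.add_apply, h, add_apply, mul_add]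

theorem D_smul (j : Fin d) (c : ℂ) {f : Rd d → ℂ} (hf : ContDiff ℝ ∞ f) :
    D j (c • f) = c • D j f := by
  funext x
  have h := fderiv_const_smul (hf.differentiable (by simp) x) c
  simp only [D, Pi.smul_apply, h, smul_apply, smul_eq_mul]
  ring

theorem D_iterate (j : Fin d) (n : ℕ) :
    (∀ f : Rd d → ℂ, ContDiff ℝ ∞ f → ContDiff ℝ ∞ ((D j)^[n] f)) ∧
    (∀ f g : Rd d → ℂ, ContDiff ℝ ∞ f → ContDiff ℝ ∞ g →
      (D j)^[n] (f + g) = (D j)^[n] f + (D j)^[n] g) ∧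
    (∀ (c : ℂ) (f : Rd d → ℂ), ContDiff ℝ ∞ f → (D j)^[n] (c • f) = c • (D j)^[n] f) := by
  induction n with
  | zero => exact ⟨fun f h => h, fun f g _ _ => rfl, fun c f _ => rfl⟩
  | succ n ih =>
    obtain ⟨h1, h2, h3⟩ := ih
    simp only [Function.iterate_succ', Function.comp_apply]
    exact ⟨fun f hf => D_smooth j (h1 f hf),
      fun f g hf hg => by rw [h2 f g hf hg, D_add j (h1 f hf) (h1 g hg)],
      fun c f hf => by rw [h3 c f hf, D_smul j c (h1 f hf)]⟩

theorem mD_aux (α : Fin d → ℕ) (l : List (Fin d)) :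
    (∀ f : Rd d → ℂ, ContDiff ℝ ∞ f →
      ContDiff ℝ ∞ (l.foldr (fun j g => (D j)^[α j] g) f)) ∧
    (∀ f g : Rd d → ℂ, ContDiff ℝ ∞ f → ContDiff ℝ ∞ g →
      l.foldr (fun j g => (D j)^[α j] g) (f + g) =
        l.foldr (fun j g => (D j)^[α j] g) f + l.foldr (fun j g => (D j)^[α j] g) g) ∧
    (∀ (c : ℂ) (f : Rd d → ℂ), ContDiff ℝ ∞ f →
      l.foldr (fun j g => (D j)^[α j] g) (c • f) =
        c • l.foldr (fun j g => (D j)^[α j] g) f) := by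
  induction l with
  | nil => exact ⟨fun f h => h, fun f g _ _ => rfl, fun c f _ => rfl⟩
  | cons j l ih =>
    obtain ⟨h1, h2, h3⟩ := ih
    obtain ⟨k1, k2, k3⟩ := D_iterate j (α j)
    simp only [List.foldr_cons]
    exact ⟨fun f hf => k1 _ (h1 f hf),
      fun f g hf hg => by rw [h2 f g hf hg, k2 _ _ (h1 f hf) (h1 g hg)],
      fun c f hf => by rw [h3 c f hf, k3 _ _ (h1 f hf)]⟩

theorem mD_smooth (α : Fin d → ℕ) {f : Rd d → ℂ} (hf : ContDiff ℝ ∞ f) :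
    ContDiff ℝ ∞ (mD α f) := (mD_aux α _).1 f hf

theorem mD_add (α : Fin d → ℕ) {f g : Rd d → ℂ} (hf : ContDiff ℝ ∞ f)
    (hg : ContDiff ℝ ∞ g) : mD α (f + g) = mD α f + mD α g := (mD_aux α _).2.1 f g hf hg

theorem mD_smul (α : Fin d → ℕ) (c : ℂ) {f : Rd d → ℂ} (hf : ContDiff ℝ ∞ f) :
    mD α (c • f) = c • mD α f := (mD_aux α _).2.2 c f hf

theorem mD_zero (α : Fin d → ℕ) : mD α (0 : Rd d → ℂ) = 0 := by
  have h := mD_smul α 0 (contDiff_const : ContDiff ℝ ∞ (fun _ : Rd d => (0 : ℂ)))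
  rw [zero_smul, zero_smul] at h
  exact h

end Linearity

/-! ### The function spaces -/

/-- The quotient `|D^α φ(x)| / (T_α M_α)`, as a function of the pair `(α, x)`. -/
def quot (M : WeightSequence) {d : ℕ} (t : IncSeq) (φ : Rd d → ℂ)
    (p : (Fin d → ℕ) × Rd d) : ℝ :=
  ‖mD p.1 φ p.2‖ / (t.prod (len p.1) * M.M (len p.1))

theorem den_pos (M : WeightSequence) (t : IncSeq) (n : ℕ) : 0 < t.prod n * M.M n :=
  mul_pos (t.prod_pos n) (M.pos n)

theorem quot_nonneg (M : WeightSequence) {d : ℕ} (t : IncSeq) (φ : Rd d → ℂ)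
    (p : (Fin d → ℕ) × Rd d) : 0 ≤ quot M t φ p :=
  div_nonneg (norm_nonneg _) (den_pos M t _).le

theorem quot_add (M : WeightSequence) {d : ℕ} (t : IncSeq) {φ ψ : Rd d → ℂ}
    (hφ : ContDiff ℝ ∞ φ) (hψ : ContDiff ℝ ∞ ψ) (p : (Fin d → ℕ) × Rd d) :
    quot M t (φ + ψ) p ≤ quot M t φ p + quot M t ψ p := by
  unfold quot
  rw [mD_add _ hφ hψ, ← add_div]
  exact div_le_div_of_nonneg_right (norm_add_le _ _) (den_pos M t _).le

theorem quot_smul (M : WeightSequence) {d : ℕ} (t : IncSeq) (c : ℂ) {φ : Rd d → ℂ}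
    (hφ : ContDiff ℝ ∞ φ) (p : (Fin d → ℕ) × Rd d) :
    quot M t (c • φ) p = ‖c‖ * quot M t φ p := by
  unfold quot
  rw [mD_smul _ _ hφ, Pi.smul_apply, norm_smul, mul_div_assoc]

theorem quot_zero (M : WeightSequence) {d : ℕ} (t : IncSeq) (p : (Fin d → ℕ) × Rd d) :
    quot M t (0 : Rd d → ℂ) p = 0 := by
  simp [quot, mD_zero]

/-- The vector space of all smooth `φ` for which
`‖φ‖_{(t_j)} = sup_{α, x} |D^α φ(x)| / (T_α M_α)` is finite for every `(t_j) ∈ ℜ`. -/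
def boundedSpace (M : WeightSequence) (d : ℕ) : Submodule ℂ (Rd d → ℂ) where
  carrier := {φ | ContDiff ℝ ∞ φ ∧ ∀ t : IncSeq, BddAbove (Set.range (quot M t φ))}
  zero_mem' := ⟨contDiff_const, fun t => ⟨0, by
    rintro _ ⟨p, rfl⟩
    exact (quot_zero M t p).le⟩⟩
  add_mem' := by
    rintro φ ψ ⟨hφ, bφ⟩ ⟨hψ, bψ⟩
    refine ⟨hφ.add hψ, fun t => ?_⟩
    obtain ⟨A, hA⟩ := bφ t
    obtain ⟨B, hB⟩ := bψ t
    refine ⟨A + B, ?_⟩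
    rintro _ ⟨p, rfl⟩
    exact (quot_add M t hφ hψ p).trans (add_le_add (hA ⟨p, rfl⟩) (hB ⟨p, rfl⟩))
  smul_mem' := by
    rintro c φ ⟨hφ, bφ⟩
    refine ⟨hφ.const_smul c, fun t => ?_⟩
    obtain ⟨A, hA⟩ := bφ t
    refine ⟨‖c‖ * A, ?_⟩
    rintro _ ⟨p, rfl⟩
    rw [quot_smul M t c hφ p]
    exact mul_le_mul_of_nonneg_left (hA ⟨p, rfl⟩) (norm_nonneg c)

/-- The space `𝒟^{{M_p}}` of Roumieu test functions on `ℝ^d`: smooth functions `φ` with compact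
support such that `|D^α φ(x)| ≤ C h^{|α|} M_α` for some `h, C > 0` and all `α`, `x`. -/
def testSpace (M : WeightSequence) (d : ℕ) : Submodule ℂ (Rd d → ℂ) where
  carrier := {φ | ContDiff ℝ ∞ φ ∧ HasCompactSupport φ ∧ ∃ h C : ℝ, 0 < h ∧ 0 < C ∧
    ∀ (α : Fin d → ℕ) (x : Rd d), ‖mD α φ x‖ ≤ C * (h ^ len α * M.M (len α))}
  zero_mem' := ⟨contDiff_const, HasCompactSupport.zero, 1, 1, one_pos, one_pos, fun α x => by
    rw [mD_zero]
    simpa using (M.pos (len α)).le⟩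
  add_mem' := by
    rintro φ ψ ⟨hφ, sφ, h, C, h0, C0, H⟩ ⟨hψ, sψ, k, E, k0, E0, K⟩
    refine ⟨hφ.add hψ, sφ.add sψ, max h k, C + E, lt_max_of_lt_left h0, add_pos C0 E0,
      fun α x => ?_⟩
    rw [mD_add α hφ hψ]
    have hM := (M.pos (len α)).le
    have e1 : C * (h ^ len α * M.M (len α)) ≤ C * (max h k ^ len α * M.M (len α)) := by
      gcongr
      exact le_max_left _ _
    have e2 : E * (k ^ len α * M.M (len α)) ≤ E * (max h k ^ len α * M.M (len α)) := by
      gcongr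
      exact le_max_right _ _
    have e3 := norm_add_le (mD α φ x) (mD α ψ x)
    have e4 := H α x
    have e5 := K α x
    simp only [Pi.add_apply]
    linarith
  smul_mem' := by
    rintro c φ ⟨hφ, sφ, h, C, h0, C0, H⟩
    refine ⟨hφ.const_smul c, sφ.smul_left (f := fun _ => c), h, (‖c‖ + 1) * C, h0,
      by positivity, fun α x => ?_⟩
    rw [mD_smul α c hφ, Pi.smul_apply, norm_smul, mul_assoc]
    exact mul_le_mul (by linarith) (H α x) (norm_nonneg _) (by positivity)

/-- `h^k / T_k` is bounded, since `t_j → ∞`. -/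
theorem pow_div_prod_bdd (t : IncSeq) {h : ℝ} (h0 : 0 < h) :
    ∃ B : ℝ, 0 < B ∧ ∀ k, h ^ k ≤ B * t.prod k := by
  obtain ⟨N, hN⟩ := (t.2.2.2.eventually_ge_atTop h).exists_forall_of_atTop
  have key : ∀ n, ∃ B : ℝ, 0 < B ∧ ∀ k ≤ n, h ^ k ≤ B * t.prod k := by
    intro n
    refine ⟨∑ k ∈ Finset.range (n + 1), h ^ k / t.prod k,
      Finset.sum_pos (fun k _ => div_pos (pow_pos h0 k) (t.prod_pos k)) ⟨0, by simp⟩,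
      fun k hk => ?_⟩
    rw [← div_le_iff₀ (t.prod_pos k)]
    exact Finset.single_le_sum (f := fun k => h ^ k / t.prod k)
      (fun k _ => (div_pos (pow_pos h0 k) (t.prod_pos k)).le)
      (Finset.mem_range.2 (Nat.lt_succ_of_le hk))
  obtain ⟨B, B0, hB⟩ := key N
  refine ⟨B, B0, fun k => ?_⟩
  rcases le_total k N with hk | hk
  · exact hB k hk
  · induction k, hk using Nat.le_induction with
    | base => exact hB N le_rfl
    | succ k hk ih =>
      have e : t.prod (k + 1) = t.prod k * t.1 k := Finset.prod_range_succ _ _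
      rw [pow_succ, e, ← mul_assoc]
      exact mul_le_mul ih (hN k hk) h0.le (mul_pos B0 (t.prod_pos k)).le

theorem testSpace_le_boundedSpace (M : WeightSequence) (d : ℕ) :
    testSpace M d ≤ boundedSpace M d := by
  rintro φ ⟨hφ, -, h, C, h0, C0, H⟩
  refine ⟨hφ, fun t => ?_⟩
  obtain ⟨B, B0, hB⟩ := pow_div_prod_bdd t h0
  refine ⟨C * B, ?_⟩
  rintro _ ⟨⟨α, x⟩, rfl⟩
  simp only [quot]
  rw [div_le_iff₀ (den_pos M t _)]
  refine (H α x).trans ?_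
  have := mul_le_mul_of_nonneg_right (hB (len α)) (M.pos (len α)).le
  calc C * (h ^ len α * M.M (len α)) ≤ C * (B * t.prod (len α) * M.M (len α)) := by gcongr
    _ = C * B * (t.prod (len α) * M.M (len α)) := by ring

/-! ### The two topologies -/

/-- The norm `‖φ‖_{(t_j)} = sup_{α, x} |D^α φ(x)| / (T_α M_α)`. -/
def normSeminorm (M : WeightSequence) (d : ℕ) (t : IncSeq) : Seminorm ℂ (boundedSpace M d) :=
  Seminorm.of (fun φ => ⨆ p, quot M t φ.1 p)
    (fun φ ψ => ciSup_le fun p => (quot_add M t φ.2.1 ψ.2.1 p).trans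
      (add_le_add (le_ciSup (φ.2.2 t) p) (le_ciSup (ψ.2.2 t) p)))
    (fun c φ => by
      rw [Real.mul_iSup_of_nonneg (norm_nonneg c)]
      exact iSup_congr fun p => quot_smul M t c φ.2.1 p)

/-- The family `|g(x) D^α φ(x)| / (T_α M_α)` is bounded for `g ∈ 𝒞₀`. -/
theorem weighted_bdd (M : WeightSequence) (d : ℕ) (g : C₀(Rd d, ℂ)) (t : IncSeq)
    (φ : boundedSpace M d) :
    BddAbove (Set.range fun p : (Fin d → ℕ) × Rd d => ‖g p.2‖ * quot M t φ.1 p) := by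
  obtain ⟨A, hA⟩ := φ.2.2 t
  refine ⟨‖g.toBCF‖ * A, ?_⟩
  rintro _ ⟨p, rfl⟩
  exact mul_le_mul (g.toBCF.norm_coe_le_norm p.2) (hA ⟨p, rfl⟩) (quot_nonneg M t _ p)
    (norm_nonneg _)

/-- The seminorm `p_{g,(t_j)}(φ) = sup_{α, x} |g(x) D^α φ(x)| / (T_α M_α)`, for `g ∈ 𝒞₀`. -/
def weightedSeminorm (M : WeightSequence) (d : ℕ) (i : C₀(Rd d, ℂ) × IncSeq) :
    Seminorm ℂ (boundedSpace M d) :=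
  Seminorm.of (fun φ => ⨆ p : (Fin d → ℕ) × Rd d, ‖i.1 p.2‖ * quot M i.2 φ.1 p)
    (fun φ ψ => ciSup_le fun p =>
      (mul_le_mul_of_nonneg_left (quot_add M i.2 φ.2.1 ψ.2.1 p) (norm_nonneg _)).trans
        ((mul_add _ _ _).le.trans
          (add_le_add (le_ciSup (weighted_bdd M d i.1 i.2 φ) p)
            (le_ciSup (weighted_bdd M d i.1 i.2 ψ) p))))
    (fun c φ => by
      rw [Real.mul_iSup_of_nonneg (norm_nonneg c)]
      refine iSup_congr fun p => ?_
      have h : quot M i.2 (c • φ : boundedSpace M d).1 p = ‖c‖ * quot M i.2 φ.1 p :=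
        quot_smul M i.2 c φ.2.1 p
      rw [h]
      ring)

/-- The space of smooth functions with all norms `‖φ‖_{(t_j)}` finite, with the locally convex
topology that these norms define. It is a type of its own, so that the
topology of pointwise convergence on functions plays no role. -/
def DInf (M : WeightSequence) (d : ℕ) : Type := boundedSpace M d

instance (M : WeightSequence) (d : ℕ) : AddCommGroup (DInf M d) :=
  inferInstanceAs (AddCommGroup (boundedSpace M d))

instance (M : WeightSequence) (d : ℕ) : Module ℂ (DInf M d) :=
  inferInstanceAs (Module ℂ (boundedSpace M d))

/-- The norms `‖·‖_{(t_j)}`, as a family of seminorms indexed by `(t_j) ∈ ℜ`. -/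
def DInf.seminorms (M : WeightSequence) (d : ℕ) : SeminormFamily ℂ (DInf M d) IncSeq :=
  normSeminorm M d

instance (M : WeightSequence) (d : ℕ) : TopologicalSpace (DInf M d) :=
  (DInf.seminorms M d).moduleFilterBasis.topology

theorem DInf.withSeminorms (M : WeightSequence) (d : ℕ) : WithSeminorms (DInf.seminorms M d) :=
  ⟨rfl⟩

instance (M : WeightSequence) (d : ℕ) : IsTopologicalAddGroup (DInf M d) :=
  (DInf.withSeminorms M d).topologicalAddGroup

instance (M : WeightSequence) (d : ℕ) : ContinuousSMul ℂ (DInf M d) :=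
  (DInf.withSeminorms M d).continuousSMul

/-- The same vector space with the weaker locally convex topology that is defined by
the seminorms `p_{g,(t_j)}`, where `g ∈ 𝒞₀` and `(t_j) ∈ ℜ`. -/
def DInfWeighted (M : WeightSequence) (d : ℕ) : Type := boundedSpace M d

instance (M : WeightSequence) (d : ℕ) : AddCommGroup (DInfWeighted M d) :=
  inferInstanceAs (AddCommGroup (boundedSpace M d))

instance (M : WeightSequence) (d : ℕ) : Module ℂ (DInfWeighted M d) :=
  inferInstanceAs (Module ℂ (boundedSpace M d))

/-- The seminorms `p_{g,(t_j)}`, as a family indexed by `𝒞₀ × ℜ`. -/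
def DInfWeighted.seminorms (M : WeightSequence) (d : ℕ) :
    SeminormFamily ℂ (DInfWeighted M d) (C₀(Rd d, ℂ) × IncSeq) :=
  weightedSeminorm M d

instance (M : WeightSequence) (d : ℕ) : TopologicalSpace (DInfWeighted M d) :=
  (DInfWeighted.seminorms M d).moduleFilterBasis.topology

theorem DInfWeighted.withSeminorms (M : WeightSequence) (d : ℕ) :
    WithSeminorms (DInfWeighted.seminorms M d) :=
  ⟨rfl⟩

instance (M : WeightSequence) (d : ℕ) : IsTopologicalAddGroup (DInfWeighted M d) :=
  (DInfWeighted.withSeminorms M d).topologicalAddGroup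

instance (M : WeightSequence) (d : ℕ) : ContinuousSMul ℂ (DInfWeighted M d) :=
  (DInfWeighted.withSeminorms M d).continuousSMul

/-! ### The closure of the test functions, the duals and the restriction maps -/

/-- The inclusion of the test functions into the space with the norms `‖·‖_{(t_j)}`. -/
def testToDInf (M : WeightSequence) (d : ℕ) : testSpace M d →ₗ[ℂ] DInf M d :=
  Submodule.inclusion (testSpace_le_boundedSpace M d)

/-- The identity map from the space with the norms `‖·‖_{(t_j)}` to the
space with the seminorms `p_{g,(t_j)}`. -/
def DInf.toWeighted (M : WeightSequence) (d : ℕ) : DInf M d →ₗ[ℂ] DInfWeighted M d :=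
  (LinearMap.id : boundedSpace M d →ₗ[ℂ] boundedSpace M d)

/-- The completion of the test functions in the complete space `DInf M d`, that is, their closure,
with the induced topology. -/
def BDot (M : WeightSequence) (d : ℕ) : Submodule ℂ (DInf M d) :=
  (LinearMap.range (testToDInf M d)).topologicalClosure

/-- The inclusion of the test functions into their completion. -/
def testToBDot (M : WeightSequence) (d : ℕ) : testSpace M d →ₗ[ℂ] BDot M d :=
  (testToDInf M d).codRestrict (BDot M d) fun φ =>
    Submodule.le_topologicalClosure _ (LinearMap.mem_range_self _ φ)

/-- The dual of `BDot M d`. The type `StrongDual` carries the strong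
topology: uniform convergence on the (von Neumann) bounded sets. -/
abbrev DualL1 (M : WeightSequence) (d : ℕ) : Type := StrongDual ℂ (BDot M d)

/-- The strong dual of `DInfWeighted M d`. -/
abbrev DualWeighted (M : WeightSequence) (d : ℕ) : Type := StrongDual ℂ (DInfWeighted M d)

/-- A continuous functional on `BDot M d`, regarded as a functional on the test functions. -/
def DualL1.onTest {M : WeightSequence} {d : ℕ} (T : DualL1 M d) : testSpace M d →ₗ[ℂ] ℂ :=
  T.toLinearMap ∘ₗ testToBDot M d

/-- A continuous functional on `DInfWeighted M d`, regarded as a functional on the test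
functions. -/
def DualWeighted.onTest {M : WeightSequence} {d : ℕ} (T : DualWeighted M d) :
    testSpace M d →ₗ[ℂ] ℂ :=
  T.toLinearMap ∘ₗ DInf.toWeighted M d ∘ₗ testToDInf M d

end Roumieu

end

/-!
After restriction to the test functions, both duals consist of the functionals `T` that satisfy
an estimate `|T φ| ≤ C ‖φ‖_{(t_j)}` for some `(t_j) ∈ ℜ`.

The point is that such a functional is small at infinity
(`exists_norm_apply_le_of_eq_zero_on_ball`): for each `ε > 0` there is a ball such that
`|T φ| ≤ ε ‖φ‖_{(t_j)}` for all test functions `φ` that vanish on it. Otherwise there would be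
arbitrarily many test functions with disjoint supports and of bounded norm at which `T` has the
value `1`; their sum has the same bound for its norm, since the norm is a supremum over points, but
`T` is unbounded on the sums. With a partition of unity whose members `χ_{n+1} - χ_n` move out to
infinity fast enough, this gives `|T φ| ≤ C' p_{g,(t_j/2)}(φ)` for a suitable `g ∈ 𝒞₀`, together with
an extension `lim T(χ_n φ)` of `T` to all of `DInfWeighted M d` (`exists_extension`).

The test functions are dense in `DInfWeighted M d`, because `χ_n φ → φ` (`tendsto_mulLeft`). That
`χ_n φ` is a test function needs an estimate with one fixed geometric factor `h^{|α|}` in place of the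
estimates for all `(t_j)` (`exists_pow_bound`).

The cutoff functions `χ_n` come from the non-quasianalyticity of `(M_p)`: a ramp on the line is
averaged over intervals of the lengths `M_j / M_{j+1}`, the sum of which is finite
(`WeightSequence.exists_step`), and `χ_n` is a tensor product of differences of translates of
the resulting step function (`exists_isCutoff`). Their derivatives have bounds
that do not depend on `n`. Products are estimated by the Leibniz rule and
`M_p M_q ≤ M_{p+q}` (`exists_quot_mul_le`).
-/

noncomputable section

namespace Roumieu

open Filter

/-! ### A smooth step function on the line -/

/-- A ramp: a nondecreasing `1`-Lipschitz function that is `0` on `(-∞, 0]`, is `1` on `[A, ∞)` and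
takes its values in `[0, 1]`. -/
structure IsRamp (A : ℝ) (f : ℝ → ℝ) : Prop where
  mono : Monotone f
  lip : LipschitzWith 1 f
  nonneg : ∀ x, 0 ≤ f x
  le_one : ∀ x, f x ≤ 1
  eq_zero : ∀ x, x ≤ 0 → f x = 0
  eq_one : ∀ x, A ≤ x → f x = 1

theorem IsRamp.weaken {A B : ℝ} {f : ℝ → ℝ} (hf : IsRamp A f) (h : A ≤ B) : IsRamp B f :=
  { hf with eq_one := fun x hx => hf.eq_one x (h.trans hx) }

theorem isRamp_clamp : IsRamp 1 (fun x => max 0 (min 1 x)) where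
  mono := fun x y h => max_le_max le_rfl (min_le_min le_rfl h)
  lip := (LipschitzWith.id.const_min 1).const_max 0
  nonneg := fun x => le_max_left _ _
  le_one := fun x => max_le zero_le_one (min_le_left _ _)
  eq_zero := fun x hx => max_eq_left ((min_le_right _ _).trans hx)
  eq_one := fun x hx => by simp [hx]

theorem IsRamp.of_tendsto {A : ℝ} {f : ℕ → ℝ → ℝ} {g : ℝ → ℝ} (hf : ∀ k, IsRamp A (f k))
    (h : ∀ x, Tendsto (fun k => f k x) atTop (𝓝 (g x))) : IsRamp A g where
  mono := fun x y hxy => le_of_tendsto_of_tendsto' (h x) (h y) fun k => (hf k).mono hxy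
  lip := LipschitzWith.of_dist_le_mul fun x y =>
    le_of_tendsto ((h x).dist (h y)) (Eventually.of_forall fun k => (hf k).lip.dist_le_mul x y)
  nonneg := fun x => ge_of_tendsto' (h x) fun k => (hf k).nonneg x
  le_one := fun x => le_of_tendsto' (h x) fun k => (hf k).le_one x
  eq_zero := fun x hx => tendsto_nhds_unique (h x)
    (tendsto_const_nhds.congr fun k => ((hf k).eq_zero x hx).symm)
  eq_one := fun x hx => tendsto_nhds_unique (h x)
    (tendsto_const_nhds.congr fun k => ((hf k).eq_one x hx).symm)

/-- The mean value of `f` over the interval `[x - a, x]`, that is, the convolution of `f` with the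
normalized indicator function of `[0, a]`. -/
def avg (a : ℝ) (f : ℝ → ℝ) (x : ℝ) : ℝ := ∫ s in (0 : ℝ)..1, f (x - a * s)

theorem intervalIntegrable_avg (a : ℝ) {f : ℝ → ℝ} (hf : Continuous f) (x : ℝ) :
    IntervalIntegrable (fun s => f (x - a * s)) MeasureTheory.volume 0 1 :=
  (hf.comp (by fun_prop)).intervalIntegrable _ _

theorem avg_le_avg (a : ℝ) {f g : ℝ → ℝ} (hf : Continuous f) (hg : Continuous g)
    (h : ∀ x, f x ≤ g x) (x : ℝ) : avg a f x ≤ avg a g x :=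
  intervalIntegral.integral_mono zero_le_one (intervalIntegrable_avg a hf x)
    (intervalIntegrable_avg a hg x) fun _ => h _

theorem avg_eq_const (a : ℝ) {f : ℝ → ℝ} {x c : ℝ}
    (h : ∀ s ∈ Set.Icc (0 : ℝ) 1, f (x - a * s) = c) : avg a f x = c := by
  have : avg a f x = ∫ _s in (0 : ℝ)..1, c :=
    intervalIntegral.integral_congr fun s hs => h s (by simpa using hs)
  simpa using this

theorem IsRamp.avg {A a : ℝ} {f : ℝ → ℝ} (hf : IsRamp A f) (ha : 0 ≤ a) :
    IsRamp (A + a) (avg a f) where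
  mono := fun x y h => intervalIntegral.integral_mono zero_le_one
    (intervalIntegrable_avg a hf.lip.continuous x) (intervalIntegrable_avg a hf.lip.continuous y)
    fun _ => hf.mono (by linarith)
  lip := LipschitzWith.of_dist_le_mul fun x y => by
    rw [dist_eq_norm, Roumieu.avg, Roumieu.avg, ← intervalIntegral.integral_sub
      (intervalIntegrable_avg a hf.lip.continuous x) (intervalIntegrable_avg a hf.lip.continuous y)]
    refine (intervalIntegral.norm_integral_le_of_norm_le_const (C := dist x y) fun s _ => ?_).trans
      (by simp)
    have := hf.lip.dist_le_mul (x - a * s) (y - a * s)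
    simpa [dist_eq_norm] using this
  nonneg := fun x => intervalIntegral.integral_nonneg zero_le_one fun _ _ => hf.nonneg _
  le_one := fun x => by
    have := intervalIntegral.integral_mono zero_le_one
      (intervalIntegrable_avg a hf.lip.continuous x)
      (intervalIntegrable_const (c := (1 : ℝ))) fun s => hf.le_one _
    simpa [Roumieu.avg] using this
  eq_zero := fun x hx => avg_eq_const a fun s hs => hf.eq_zero _ (by nlinarith [hs.1])
  eq_one := fun x hx => avg_eq_const a fun s hs => hf.eq_one _ (by nlinarith [hs.2])

theorem IsRamp.avg_le {A a : ℝ} {f : ℝ → ℝ} (hf : IsRamp A f) (ha : 0 ≤ a) (x : ℝ) :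
    Roumieu.avg a f x ≤ f x := by
  have := intervalIntegral.integral_mono_on zero_le_one
    (intervalIntegrable_avg a hf.lip.continuous x)
    (intervalIntegrable_const (c := f x)) fun s hs => hf.mono (by nlinarith [hs.1])
  simpa [Roumieu.avg] using this

theorem hasDerivAt_avg {a : ℝ} (ha : a ≠ 0) {f : ℝ → ℝ} (hf : Continuous f) (x : ℝ) :
    HasDerivAt (avg a f) (a⁻¹ * (f x - f (x - a))) x := by
  have e : avg a f = fun x => a⁻¹ * ((∫ y in (0 : ℝ)..x, f y) - ∫ y in (0 : ℝ)..(x - a), f y) := by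
    funext x
    rw [avg, intervalIntegral.integral_comp_sub_mul f ha, intervalIntegral.integral_interval_sub_left
      (hf.intervalIntegrable _ _) (hf.intervalIntegrable _ _)]
    simp
  rw [e]
  have h : ∀ z, HasDerivAt (fun x => ∫ y in (0 : ℝ)..x, f y) (f z) z := fun z =>
    intervalIntegral.integral_hasDerivAt_right (hf.intervalIntegrable _ _)
      hf.stronglyMeasurable.stronglyMeasurableAtFilter hf.continuousAt
  have h2 : HasDerivAt (fun x => ∫ y in (0 : ℝ)..(x - a), f y) (f (x - a)) x := by
    simpa using (h (x - a)).comp_sub_const x a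
  exact ((h x).sub h2).const_mul _

/-- The ramp `x ↦ max 0 (min 1 x)`, averaged over intervals of the lengths
`a n, …, a (n + k - 1)`. -/
def ramp (a : ℕ → ℝ) : ℕ → ℕ → ℝ → ℝ
  | _, 0 => fun x => max 0 (min 1 x)
  | n, k + 1 => avg (a n) (ramp a (n + 1) k)

theorem isRamp_ramp {a : ℕ → ℝ} (ha : ∀ j, 0 ≤ a j) (k n : ℕ) :
    IsRamp (1 + ∑ j ∈ Finset.range k, a (n + j)) (ramp a n k) := by
  induction k generalizing n with
  | zero => simpa [ramp] using isRamp_clamp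
  | succ k ih =>
    refine ((ih (n + 1)).avg (ha n)).weaken (le_of_eq ?_)
    rw [Finset.sum_range_succ', add_zero, ← add_assoc]
    simp only [add_comm, add_left_comm]

theorem isRamp_ramp_tsum {a : ℕ → ℝ} (ha : ∀ j, 0 ≤ a j) (hs : Summable a) (k n : ℕ) :
    IsRamp (1 + ∑' j, a j) (ramp a n k) := by
  refine (isRamp_ramp ha k n).weaken (add_le_add le_rfl ?_)
  rw [← Finset.sum_image (s := Finset.range k) (g := fun j => n + j) (f := a)
    (fun _ _ _ _ h => Nat.add_left_cancel h)]
  exact hs.sum_le_tsum _ fun j _ => ha j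

theorem ramp_antitone {a : ℕ → ℝ} (ha : ∀ j, 0 ≤ a j) (n : ℕ) (x : ℝ) :
    Antitone fun k => ramp a n k x := by
  refine antitone_nat_of_succ_le fun k => ?_
  induction k generalizing n x with
  | zero => exact isRamp_clamp.avg_le (ha n) x
  | succ k ih =>
    exact avg_le_avg _ (isRamp_ramp ha (k + 1) (n + 1)).lip.continuous
      (isRamp_ramp ha k (n + 1)).lip.continuous (fun y => ih (n + 1) y) x

/-- The limit of the averaged ramps, a ramp averaged over intervals of the lengths
`a n, a (n + 1), …`. -/
def rampLim (a : ℕ → ℝ) (n : ℕ) (x : ℝ) : ℝ := ⨅ k, ramp a n k x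

theorem tendsto_ramp {a : ℕ → ℝ} (ha : ∀ j, 0 ≤ a j) (n : ℕ) (x : ℝ) :
    Tendsto (fun k => ramp a n k x) atTop (𝓝 (rampLim a n x)) :=
  tendsto_atTop_ciInf (ramp_antitone ha n x)
    ⟨0, by rintro _ ⟨k, rfl⟩; exact (isRamp_ramp ha k n).nonneg x⟩

theorem isRamp_rampLim {a : ℕ → ℝ} (ha : ∀ j, 0 ≤ a j) (hs : Summable a) (n : ℕ) :
    IsRamp (1 + ∑' j, a j) (rampLim a n) :=
  IsRamp.of_tendsto (fun k => isRamp_ramp_tsum ha hs k n) (tendsto_ramp ha n)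

theorem rampLim_eq_avg {a : ℕ → ℝ} (ha : ∀ j, 0 ≤ a j) (n : ℕ) :
    rampLim a n = avg (a n) (rampLim a (n + 1)) := by
  funext x
  refine tendsto_nhds_unique ((tendsto_ramp ha n x).comp (tendsto_add_atTop_nat 1)) ?_
  refine intervalIntegral.tendsto_integral_filter_of_dominated_convergence (fun _ => 1)
    (Eventually.of_forall fun k => ?_) (Eventually.of_forall fun k => ?_) (by simp) ?_
  · exact (((isRamp_ramp ha k (n + 1)).lip.continuous.comp
      (by fun_prop : Continuous fun s => x - a n * s))).aestronglyMeasurable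
  · refine Eventually.of_forall fun s _ => ?_
    have h := isRamp_ramp ha k (n + 1)
    rw [Real.norm_of_nonneg (h.nonneg _)]
    exact h.le_one _
  · exact Eventually.of_forall fun s _ => tendsto_ramp ha (n + 1) _

/-- Each derivative costs one average: if `(G n)' = Δ_n G (n + 1)`, where `Δ_n` is the difference
quotient with step `a n`, then `(G n)⁽ᵐ⁾ = Δ_n ⋯ Δ_{n+m-1} G (n + m)`, which is at
most `∏ 2 / a (n + j)`. -/
theorem iteratedDeriv_bound_of_differences {a : ℕ → ℝ} (ha : ∀ j, 0 < a j) {G : ℕ → ℝ → ℂ}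
    (hG : ∀ n x, HasDerivAt (G n) (((a n)⁻¹ : ℝ) • (G (n + 1) x - G (n + 1) (x - a n))) x)
    (h1 : ∀ n x, ‖G n x‖ ≤ 1) (m n : ℕ) :
    ContDiff ℝ m (G n) ∧
      ∀ x, ‖iteratedDeriv m (G n) x‖ ≤ ∏ j ∈ Finset.range m, 2 / a (n + j) := by
  induction m generalizing n with
  | zero =>
    refine ⟨?_, fun x => by simpa using h1 n x⟩
    exact contDiff_zero.2 (continuous_iff_continuousAt.2 fun x => (hG n x).continuousAt)
  | succ m ih =>
    obtain ⟨c, b⟩ := ih (n + 1)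
    have e : deriv (G n) = (a n)⁻¹ • (G (n + 1) - fun x => G (n + 1) (x - a n)) :=
      funext fun x => (hG n x).deriv
    have c' : ContDiff ℝ m fun x => G (n + 1) (x - a n) := c.comp (contDiff_id.sub contDiff_const)
    refine ⟨?_, fun x => ?_⟩
    · push_cast
      refine contDiff_succ_iff_deriv.2 ⟨fun x => (hG n x).differentiableAt, by simp, ?_⟩
      rw [e]
      exact contDiff_const.smul (c.sub c')
    · rw [iteratedDeriv_succ', e, iteratedDeriv_const_smul_field,
        iteratedDeriv_sub c.contDiffAt c'.contDiffAt, iteratedDeriv_comp_sub_const,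
        Finset.prod_range_succ', norm_smul, norm_inv, Real.norm_of_nonneg (ha n).le]
      have e2 := (norm_sub_le (iteratedDeriv m (G (n + 1)) x)
        (iteratedDeriv m (G (n + 1)) (x - a n))).trans (add_le_add (b x) (b (x - a n)))
      have e3 := mul_le_mul_of_nonneg_left e2 (inv_pos.2 (ha n)).le
      refine e3.trans (le_of_eq ?_)
      simp only [add_zero, add_assoc, add_comm 1]
      ring

theorem WeightSequence.summable_ratio (M : WeightSequence) :
    Summable fun k : ℕ => M.M k / M.M (k + 1) := by
  obtain ⟨c, -, h⟩ := M.m3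
  have := (h 1 le_rfl).1
  rw [← summable_nat_add_iff 1]
  refine this.congr fun k => ?_
  rw [add_comm 1 k]

theorem WeightSequence.prod_ratio (M : WeightSequence) (n : ℕ) :
    ∏ j ∈ Finset.range n, 2 / (M.M j / M.M (j + 1)) = 2 ^ n * M.M n := by
  induction n with
  | zero => simp [M.zero_eq_one]
  | succ n ih =>
    rw [Finset.prod_range_succ, ih]
    have := (M.pos n).ne'
    have := (M.pos (n + 1)).ne'
    field_simp
    ring

/-- Non-quasianalyticity in the form that is used: there is a smooth step function on the line
whose derivatives satisfy the estimates of the class. It is a limit of averages over intervals of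
the lengths `M_j / M_{j+1}`, which are summable by (M.3). -/
theorem WeightSequence.exists_step (M : WeightSequence) :
    ∃ (F : ℝ → ℂ) (A : ℝ), 0 ≤ A ∧ ContDiff ℝ ∞ F ∧ (∀ x ≤ 0, F x = 0) ∧ (∀ x, A ≤ x → F x = 1) ∧
      ∀ n x, ‖iteratedDeriv n F x‖ ≤ 2 ^ n * M.M n := by
  set a : ℕ → ℝ := fun k => M.M k / M.M (k + 1) with ha
  have a0 : ∀ j, 0 < a j := fun j => div_pos (M.pos _) (M.pos _)
  have hr := isRamp_rampLim (fun j => (a0 j).le) M.summable_ratio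
  have key := iteratedDeriv_bound_of_differences a0 (G := fun n x => (rampLim a n x : ℂ))
    (fun n x => by
      have h := (hasDerivAt_avg (a0 n).ne' (hr (n + 1)).lip.continuous x).ofReal_comp
      rw [← rampLim_eq_avg (fun j => (a0 j).le) n] at h
      simpa using h)
    (fun n x => by
      rw [Complex.norm_real, Real.norm_of_nonneg ((hr n).nonneg x)]
      exact (hr n).le_one x)
  refine ⟨fun x => (rampLim a 0 x : ℂ), 1 + ∑' j, a j,
    add_nonneg zero_le_one (tsum_nonneg fun j => (a0 j).le),
    contDiff_infty.2 fun m => (key m 0).1, fun x hx => ?_, fun x hx => ?_, fun n x => ?_⟩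
  · simp [(hr 0).eq_zero x hx]
  · simp [(hr 0).eq_one x hx]
  · refine ((key n 0).2 x).trans (le_of_eq ?_)
    simpa only [ha, zero_add] using M.prod_ratio n

/-! ### Iterated partial derivatives and the Leibniz rule -/

variable {d : ℕ}

/-- `D_{j_1} ⋯ D_{j_n} f` for a word `j_1 ⋯ j_n` in the directions. -/
def wordD (w : List (Fin d)) (f : Rd d → ℂ) : Rd d → ℂ := w.foldr D f

/-- The nondecreasing word in which each letter `j` occurs `α j` times. -/
def word (α : Fin d → ℕ) : List (Fin d) :=
  (List.finRange d).flatMap fun j => List.replicate (α j) j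

theorem mD_eq_wordD (α : Fin d → ℕ) (f : Rd d → ℂ) : mD α f = wordD (word α) f := by
  unfold mD wordD word
  induction List.finRange d with
  | nil => rfl
  | cons j l ih =>
    rw [List.foldr_cons, ih, List.flatMap_cons, List.foldr_append]
    generalize List.foldr D f _ = g
    induction α j with
    | zero => rfl
    | succ n ihn => rw [Function.iterate_succ_apply', ihn, List.replicate_succ, List.foldr_cons]

theorem length_word (α : Fin d → ℕ) : (word α).length = len α := by
  simp [word, len, List.length_flatMap, Fin.sum_univ_def]

/-- The subwords of `word α` are again words of multi-indices, so that the factors in the Leibniz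
rule for `mD α` are of the form `mD β` without permuting the derivatives. -/
theorem exists_eq_word_of_sublist {α : Fin d → ℕ} {w : List (Fin d)} (h : w.Sublist (word α)) :
    ∃ β, w = word β := by
  unfold word at h ⊢
  have hn := List.nodup_finRange d
  revert hn w
  induction List.finRange d with
  | nil =>
    intro w h _
    exact ⟨0, by simpa using h⟩
  | cons j l ih =>
    intro w h hn
    rw [List.flatMap_cons, List.sublist_append_iff] at h
    obtain ⟨w1, w2, rfl, h1, h2⟩ := h
    obtain ⟨k, -, rfl⟩ := List.sublist_replicate_iff.1 h1
    obtain ⟨β, rfl⟩ := ih h2 (List.nodup_cons.1 hn).2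
    refine ⟨Function.update β j k, ?_⟩
    rw [List.flatMap_cons, Function.update_self]
    congr 1
    refine List.flatMap_congr fun i hi => ?_
    rw [Function.update_of_ne]
    rintro rfl
    exact (List.nodup_cons.1 hn).1 hi

theorem wordD_smooth (w : List (Fin d)) {f : Rd d → ℂ} (hf : ContDiff ℝ ∞ f) :
    ContDiff ℝ ∞ (wordD w f) := by
  induction w with
  | nil => exact hf
  | cons j w ih => exact D_smooth j ih

theorem wordD_add (w : List (Fin d)) {f g : Rd d → ℂ} (hf : ContDiff ℝ ∞ f)
    (hg : ContDiff ℝ ∞ g) : wordD w (f + g) = wordD w f + wordD w g := by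
  induction w with
  | nil => rfl
  | cons j w ih =>
    simp only [wordD, List.foldr_cons] at ih ⊢
    rw [ih]
    exact D_add j (wordD_smooth w hf) (wordD_smooth w hg)

theorem wordD_concat (w : List (Fin d)) (j : Fin d) (f : Rd d → ℂ) :
    wordD (w ++ [j]) f = wordD w (D j f) := by
  simp [wordD, List.foldr_append]

theorem D_mul (j : Fin d) {f g : Rd d → ℂ} (hf : ContDiff ℝ ∞ f) (hg : ContDiff ℝ ∞ g) :
    D j (f * g) = D j f * g + f * D j g := by
  funext x
  have h := fderiv_mul (hf.differentiable (by simp) x) (hg.differentiable (by simp) x)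
  simp only [D, h, Pi.add_apply, Pi.mul_apply, add_apply, smul_apply,
    smul_eq_mul]
  ring

/-- The Leibniz rule as an estimate. It has `2 ^ n` terms of the form `D_{w₁} f · D_{w₂} g`, where
the subwords `w₁` and `w₂` of `w` together have the length `n` of `w`. -/
theorem norm_wordD_mul_le (w : List (Fin d)) {f g : Rd d → ℂ} (hf : ContDiff ℝ ∞ f)
    (hg : ContDiff ℝ ∞ g) (x : Rd d) {B : ℝ}
    (h : ∀ w₁ w₂ : List (Fin d), w₁.Sublist w → w₂.Sublist w →
      w₁.length + w₂.length = w.length → ‖wordD w₁ f x‖ * ‖wordD w₂ g x‖ ≤ B) :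
    ‖wordD w (f * g) x‖ ≤ 2 ^ w.length * B := by
  induction w using List.reverseRecOn generalizing f g with
  | nil => simpa [wordD] using h [] [] (by simp) (by simp) rfl
  | append_singleton w j ih =>
    have e0 : wordD w (D j f * g + f * D j g) = wordD w (D j f * g) + wordD w (f * D j g) :=
      wordD_add w ((D_smooth j hf).mul hg) (hf.mul (D_smooth j hg))
    rw [wordD_concat, D_mul j hf hg, e0]
    have e1 := ih (D_smooth j hf) hg fun w₁ w₂ s₁ s₂ hl => by
      have := h (w₁ ++ [j]) w₂ (s₁.append (List.Sublist.refl _))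
        (s₂.trans (List.sublist_append_left _ _)) (by simp; omega)
      rwa [wordD_concat] at this
    have e2 := ih hf (D_smooth j hg) fun w₁ w₂ s₁ s₂ hl => by
      have := h w₁ (w₂ ++ [j]) (s₁.trans (List.sublist_append_left _ _))
        (s₂.append (List.Sublist.refl _)) (by simp; omega)
      rwa [wordD_concat] at this
    refine (norm_add_le _ _).trans ((add_le_add e1 e2).trans (le_of_eq ?_))
    rw [List.length_append, List.length_singleton, pow_succ]
    ring

theorem norm_mD_mul_le (α : Fin d → ℕ) {f g : Rd d → ℂ} (hf : ContDiff ℝ ∞ f)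
    (hg : ContDiff ℝ ∞ g) (x : Rd d) {B : ℝ}
    (h : ∀ β γ : Fin d → ℕ, len β + len γ = len α → ‖mD β f x‖ * ‖mD γ g x‖ ≤ B) :
    ‖mD α (f * g) x‖ ≤ 2 ^ len α * B := by
  rw [mD_eq_wordD, ← length_word]
  refine norm_wordD_mul_le _ hf hg x fun w₁ w₂ h₁ h₂ hl => ?_
  obtain ⟨β, rfl⟩ := exists_eq_word_of_sublist h₁
  obtain ⟨γ, rfl⟩ := exists_eq_word_of_sublist h₂
  rw [← mD_eq_wordD, ← mD_eq_wordD]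
  exact h β γ (by simpa only [length_word] using hl)

theorem mD_eventuallyEq (α : Fin d → ℕ) {f g : Rd d → ℂ} {x : Rd d} (h : f =ᶠ[𝓝 x] g) :
    mD α f =ᶠ[𝓝 x] mD α g := by
  rw [mD_eq_wordD, mD_eq_wordD]
  induction word α with
  | nil => exact h
  | cons j w ih =>
    filter_upwards [ih.fderiv (𝕜 := ℝ)] with y hy
    simp only [wordD, List.foldr_cons, D] at hy ⊢
    rw [hy]

theorem mD_eq_zero_of_eventuallyEq (α : Fin d → ℕ) {f : Rd d → ℂ} {x : Rd d}
    (h : f =ᶠ[𝓝 x] 0) : mD α f x = 0 := by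
  rw [(mD_eventuallyEq α h).eq_of_nhds, mD_zero, Pi.zero_apply]

theorem mD_sub (α : Fin d → ℕ) {f g : Rd d → ℂ} (hf : ContDiff ℝ ∞ f) (hg : ContDiff ℝ ∞ g) :
    mD α (f - g) = mD α f - mD α g := by
  have h := mD_add α hf (hg.const_smul (-1 : ℂ))
  have e := mD_smul α (-1) hg
  rw [show f - g = f + (-1 : ℂ) • g by simp [sub_eq_add_neg]]
  refine h.trans ?_
  rw [show (fun x => (-1 : ℂ) • g x) = (-1 : ℂ) • g from rfl, e]
  simp [sub_eq_add_neg]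

/-! ### Cutoff functions -/

/-- The tensor product `x ↦ u_1(x_1) ⋯ u_d(x_d)`. -/
def tensor (u : Fin d → ℝ → ℂ) (x : Rd d) : ℂ := ∏ i, u i (x i)

theorem tensor_smooth {u : Fin d → ℝ → ℂ} (hu : ∀ i, ContDiff ℝ ∞ (u i)) :
    ContDiff ℝ ∞ (tensor u) :=
  contDiff_prod fun i _ => (hu i).comp (EuclideanSpace.proj (𝕜 := ℝ) i).contDiff

theorem D_tensor (j : Fin d) {u : Fin d → ℝ → ℂ} (hu : ∀ i, ContDiff ℝ ∞ (u i)) :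
    D j (tensor u) = tensor (Function.update u j fun s => Complex.I⁻¹ * deriv (u j) s) := by
  funext x
  have hl : fderiv ℝ (tensor u) x (EuclideanSpace.single j 1) =
      deriv (fun s : ℝ => tensor u (x + s • EuclideanSpace.single j 1)) 0 :=
    (((tensor_smooth hu).differentiable (by simp)) x).lineDeriv_eq_fderiv.symm
  have e : (fun s : ℝ => tensor u (x + s • EuclideanSpace.single j 1)) =
      fun s => u j (s + x j) * ∏ i ∈ Finset.univ.erase j, u i (x i) := by
    funext s
    rw [tensor, ← Finset.mul_prod_erase _ _ (Finset.mem_univ j)]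
    congr 1
    · simp [add_comm]
    · refine Finset.prod_congr rfl fun i hi => ?_
      simp [(Finset.ne_of_mem_erase hi)]
  rw [D, hl, e, deriv_mul_const_field, deriv_comp_add_const, zero_add, tensor,
    ← Finset.mul_prod_erase _ _ (Finset.mem_univ j), Function.update_self, mul_assoc]
  congr 2
  refine Finset.prod_congr rfl fun i hi => ?_
  rw [Function.update_of_ne (Finset.ne_of_mem_erase hi)]

theorem wordD_tensor (w : List (Fin d)) {u : Fin d → ℝ → ℂ} (hu : ∀ i, ContDiff ℝ ∞ (u i)) :
    wordD w (tensor u) =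
      tensor fun i s => Complex.I⁻¹ ^ w.count i * iteratedDeriv (w.count i) (u i) s := by
  induction w with
  | nil => simp [wordD]
  | cons j w ih =>
    simp only [wordD, List.foldr_cons] at ih ⊢
    have hs : ∀ i n, ContDiff ℝ ∞ (iteratedDeriv n (u i)) := fun i n => by
      rw [iteratedDeriv_eq_iterate]
      exact (hu i).iterate_deriv n
    rw [ih, D_tensor j fun i => contDiff_const.mul (hs i _)]
    congr 1
    funext i s
    rcases eq_or_ne i j with rfl | hij
    · rw [Function.update_self, List.count_cons_self, deriv_const_mul_field, iteratedDeriv_succ,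
        pow_succ]
      ring
    · rw [Function.update_of_ne hij, List.count_cons_of_ne hij.symm]

/-- `M_p M_q ≤ M_{p+q}`, from (M.1) and `M_0 = 1`: the ratios `M_{p+1} / M_p` increase. -/
theorem WeightSequence.mul_le_add (M : WeightSequence) (p q : ℕ) :
    M.M p * M.M q ≤ M.M (p + q) := by
  have hm : Monotone fun p => M.M (p + 1) / M.M p := monotone_nat_of_le_succ fun p => by
    rw [div_le_div_iff₀ (M.pos _) (M.pos _), ← sq, mul_comm]
    exact M.m1 (p + 1) (by omega)
  induction q with
  | zero => simp [M.zero_eq_one]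
  | succ q ih =>
    have h : M.M (q + 1) / M.M q ≤ M.M (p + q + 1) / M.M (p + q) := hm (by omega : q ≤ p + q)
    have e := mul_le_mul h ih (mul_pos (M.pos p) (M.pos q)).le
      (div_pos (M.pos _) (M.pos _)).le
    rw [div_mul_cancel₀ _ (M.pos _).ne'] at e
    refine le_trans (le_of_eq ?_) e
    have := (M.pos q).ne'
    field_simp

theorem WeightSequence.prod_le_sum (M : WeightSequence) {ι : Type*} (s : Finset ι) (p : ι → ℕ) :
    ∏ i ∈ s, M.M (p i) ≤ M.M (∑ i ∈ s, p i) := by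
  classical
  induction s using Finset.induction_on with
  | empty => simp [M.zero_eq_one]
  | insert i s hi ih =>
    rw [Finset.prod_insert hi, Finset.sum_insert hi]
    exact (mul_le_mul_of_nonneg_left ih (M.pos _).le).trans (M.mul_le_add _ _)

/-- A smooth function that is `1` on the ball of radius `r`, vanishes outside the ball of
radius `L`, and satisfies the estimates of the class with constants that do not
depend on `r` and `L`. -/
structure IsCutoff (M : WeightSequence) (r L : ℝ) (χ : Rd d → ℂ) : Prop where
  smooth : ContDiff ℝ ∞ χ
  eq_one : ∀ x, ‖x‖ ≤ r → χ x = 1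
  eq_zero : ∀ x, L ≤ ‖x‖ → χ x = 0
  bound : ∀ (α : Fin d → ℕ) (x : Rd d), ‖mD α χ x‖ ≤ 2 ^ d * (2 ^ len α * M.M (len α))

theorem IsCutoff.hasCompactSupport {M : WeightSequence} {r L : ℝ} {χ : Rd d → ℂ}
    (h : IsCutoff M r L χ) : HasCompactSupport χ :=
  HasCompactSupport.intro (isCompact_closedBall 0 L) fun x hx =>
    h.eq_zero x (by simpa using (not_le.1 fun h' => hx (by simpa using h')).le)

/-- With the smooth step function `F`, which rises from `0` to `1` on `[0, A]`, the tensor product of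
the functions `s ↦ F(s + r + A) - F(s - r)` is a cutoff function. -/
theorem exists_isCutoff (M : WeightSequence) (d : ℕ) {r : ℝ} (hr : 0 ≤ r) :
    ∃ (L : ℝ) (χ : Rd d → ℂ), IsCutoff M r L χ := by
  obtain ⟨F, A, hA, hF, F0, F1, hb⟩ := M.exists_step
  have s1 : ContDiff ℝ ∞ fun s => F (s + (r + A)) := hF.comp (contDiff_id.add contDiff_const)
  have s2 : ContDiff ℝ ∞ fun s => F (s - r) := hF.comp (contDiff_id.sub contDiff_const)
  have hsm : ∀ _i : Fin d, ContDiff ℝ ∞ fun s : ℝ => F (s + (r + A)) - F (s - r) :=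
    fun _ => s1.sub s2
  refine ⟨√(d * (r + A) ^ 2) + 1,
    tensor fun _ s => F (s + (r + A)) - F (s - r), tensor_smooth hsm, fun x hx => ?_,
    fun x hx => ?_, fun α x => ?_⟩
  · refine Finset.prod_eq_one fun i _ => ?_
    have h := abs_le.1 ((PiLp.norm_apply_le x i).trans hx)
    beta_reduce
    rw [F1 _ (by linarith [h.1]), F0 _ (by linarith [h.2]), sub_zero]
  · obtain ⟨i, hi⟩ : ∃ i, r + A < |x i| := by
      by_contra! hc
      have h : ‖x‖ ≤ √(d * (r + A) ^ 2) := by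
        rw [EuclideanSpace.norm_eq]
        refine Real.sqrt_le_sqrt ((Finset.sum_le_sum fun i _ =>
          pow_le_pow_left₀ (norm_nonneg _) (hc i) 2).trans (by simp))
      linarith
    refine Finset.prod_eq_zero (Finset.mem_univ i) ?_
    beta_reduce
    rcases lt_abs.1 hi with h | h
    · rw [F1 _ (by linarith), F1 _ (by linarith), sub_self]
    · rw [F0 _ (by linarith), F0 _ (by linarith), sub_self]
  · rw [mD_eq_wordD, wordD_tensor _ hsm, ← length_word, tensor, norm_prod]
    have hsum : ∑ i, (word α).count i = (word α).length := by
      simpa using Multiset.sum_count_eq_card (s := Finset.univ) (m := (word α : Multiset (Fin d)))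
        fun i _ => Finset.mem_univ i
    calc _ ≤ ∏ i, 2 * (2 ^ (word α).count i * M.M ((word α).count i)) := by
          refine Finset.prod_le_prod (fun i _ => norm_nonneg _) fun i _ => ?_
          rw [norm_mul, norm_pow, norm_inv, Complex.norm_I, inv_one, one_pow, one_mul]
          have e := iteratedDeriv_sub (x := x i) (n := (word α).count i)
            (contDiff_infty.1 s1 _).contDiffAt (contDiff_infty.1 s2 _).contDiffAt
          rw [show (fun s : ℝ => F (s + (r + A)) - F (s - r)) =
            (fun s => F (s + (r + A))) - fun s => F (s - r) from rfl, e,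
            iteratedDeriv_comp_add_const, iteratedDeriv_comp_sub_const, two_mul]
          exact (norm_sub_le _ _).trans (add_le_add (hb _ _) (hb _ _))
      _ = 2 ^ d * (2 ^ (word α).length * ∏ i, M.M ((word α).count i)) := by
          rw [Finset.prod_mul_distrib, Finset.prod_mul_distrib, Finset.prod_pow_eq_pow_sum, hsum]
          simp
      _ ≤ _ := by
          have := M.prod_le_sum Finset.univ fun i => (word α).count i
          rw [hsum] at this
          gcongr

/-! ### Estimates for products with cutoff functions -/

theorem IncSeq.prod_mul_le (t : IncSeq) (a b : ℕ) : t.prod a * t.prod b ≤ t.prod (a + b) := by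
  unfold IncSeq.prod
  rw [Finset.prod_range_add]
  refine mul_le_mul_of_nonneg_left ?_ (t.prod_pos a).le
  exact Finset.prod_le_prod (fun j _ => (t.2.1 j).le) fun j _ => t.2.2.1 (Nat.le_add_left _ _)

/-- The sequence `(t_j / 2)`. -/
def IncSeq.half (t : IncSeq) : IncSeq :=
  ⟨fun j => t.1 j / 2, fun j => half_pos (t.2.1 j),
    fun _ _ h => div_le_div_of_nonneg_right (t.2.2.1 h) zero_le_two,
    t.2.2.2.atTop_div_const two_pos⟩

theorem IncSeq.half_prod (t : IncSeq) (k : ℕ) : t.half.prod k = t.prod k / 2 ^ k := by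
  simp [IncSeq.prod, IncSeq.half, Finset.prod_div_distrib]

/-- The termwise minimum of two sequences. -/
def IncSeq.min (s t : IncSeq) : IncSeq :=
  ⟨fun j => Min.min (s.1 j) (t.1 j), fun j => lt_min (s.2.1 j) (t.2.1 j),
    s.2.2.1.min t.2.2.1, tendsto_atTop.2 fun b => by
      filter_upwards [s.2.2.2.eventually_ge_atTop b, t.2.2.2.eventually_ge_atTop b] with j h1 h2
      exact le_min h1 h2⟩

theorem quot_le_quot {M : WeightSequence} {s t : IncSeq} (h : ∀ j, s.1 j ≤ t.1 j)
    (φ : Rd d → ℂ) (p : (Fin d → ℕ) × Rd d) : quot M t φ p ≤ quot M s φ p :=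
  div_le_div_of_nonneg_left (norm_nonneg _) (den_pos M s _)
    (mul_le_mul_of_nonneg_right (Finset.prod_le_prod (fun j _ => (s.2.1 j).le) fun j _ => h j)
      (M.pos _).le)

theorem quot_eq_zero_of_eventuallyEq (M : WeightSequence) (t : IncSeq) (α : Fin d → ℕ)
    {f : Rd d → ℂ} {x : Rd d} (h : f =ᶠ[𝓝 x] 0) : quot M t f (α, x) = 0 := by
  simp [quot, mD_eq_zero_of_eventuallyEq α h]

theorem quot_congr (M : WeightSequence) (t : IncSeq) (α : Fin d → ℕ)
    {f g : Rd d → ℂ} {x : Rd d} (h : f =ᶠ[𝓝 x] g) : quot M t f (α, x) = quot M t g (α, x) := by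
  simp [quot, (mD_eventuallyEq α h).eq_of_nhds]

theorem WeightSequence.mul_le_of_add_eq (M : WeightSequence) {b c n : ℕ} (h : b + c = n) :
    M.M b * M.M c ≤ M.M n := h ▸ M.mul_le_add b c

/-- Multiplication by a function of the class `{M_p}` is continuous for the norms `‖·‖_{(t_j)}`,
pointwise in `x`. Halving the sequence `(t_j)` compensates for the `2 ^ |α|` terms of the
Leibniz rule. -/
theorem exists_quot_mul_le (M : WeightSequence) (d : ℕ) (t : IncSeq) :
    ∃ K : ℝ, 0 < K ∧ ∀ (χ φ : Rd d → ℂ), ContDiff ℝ ∞ χ → ContDiff ℝ ∞ φ → ∀ (x : Rd d) (c B : ℝ),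
      0 ≤ c → 0 ≤ B → (∀ β, ‖mD β χ x‖ ≤ c * (2 ^ len β * M.M (len β))) →
      (∀ γ, quot M t.half φ (γ, x) ≤ B) → ∀ α, quot M t (χ * φ) (α, x) ≤ K * c * B := by
  obtain ⟨K, K0, hK⟩ := pow_div_prod_bdd t (h := 4) (by norm_num)
  refine ⟨K, K0, fun χ φ hχ hφ x c B hc hB h1 h2 α => ?_⟩
  rw [quot, div_le_iff₀ (den_pos M t _)]
  refine (norm_mD_mul_le α hχ hφ x
    (B := K * c * B * (t.prod (len α) * M.M (len α)) / 2 ^ len α) fun β γ hl => ?_).trans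
    (le_of_eq (by field_simp))
  have e2 := h2 γ
  rw [quot, div_le_iff₀ (den_pos M t.half _), t.half_prod] at e2
  have hTM := mul_le_mul (hl ▸ t.prod_mul_le (len β) (len γ)) (M.mul_le_of_add_eq hl)
    (mul_pos (M.pos _) (M.pos _)).le (t.prod_pos _).le
  have := (M.pos (len β)).le
  have := (M.pos (len γ)).le
  have := (t.prod_pos (len γ)).le
  calc ‖mD β χ x‖ * ‖mD γ φ x‖
      ≤ c * (2 ^ len β * M.M (len β)) * (B * (t.prod (len γ) / 2 ^ len γ * M.M (len γ))) :=
        mul_le_mul (h1 β) e2 (norm_nonneg _) (by positivity)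
    _ = c * B * 4 ^ len β * (t.prod (len γ) * (M.M (len β) * M.M (len γ))) / 2 ^ len α := by
        rw [← hl, pow_add, show (4 : ℝ) = 2 * 2 by norm_num, mul_pow]
        field_simp
    _ ≤ c * B * (K * t.prod (len β)) * (t.prod (len γ) * (M.M (len β) * M.M (len γ))) /
          2 ^ len α := by
        gcongr
        exact hK _
    _ = K * c * B * (t.prod (len β) * t.prod (len γ) * (M.M (len β) * M.M (len γ))) /
          2 ^ len α := by ring
    _ ≤ _ := by gcongr

/-- A function for which all the norms `‖·‖_{(t_j)}` are finite satisfies one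
estimate `|D^α φ| ≤ C h^{|α|} M_α`. Otherwise there are `k_0 < k_1 < …` and derivatives of the orders
`k_n` that violate the estimate with `h = C = n + 1`; then the norm for the sequence that has the
value `n + 1` between `k_{n-1}` and `k_n` is infinite. -/
theorem exists_pow_bound {M : WeightSequence} {φ : Rd d → ℂ} (hφ : φ ∈ boundedSpace M d) :
    ∃ h C : ℝ, 1 ≤ h ∧ 0 < C ∧ ∀ α x, ‖mD α φ x‖ ≤ C * (h ^ len α * M.M (len α)) := by
  by_contra! hcon
  have hfreq : ∀ n : ℕ, ∃ᶠ k in atTop, ∃ α : Fin d → ℕ, ∃ x, len α = k ∧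
      ((n : ℝ) + 1) * (((n : ℝ) + 1) ^ k * M.M k) < ‖mD α φ x‖ := by
    refine fun n => frequently_atTop.2 fun N => ?_
    by_contra! hN
    obtain ⟨t⟩ : Nonempty IncSeq := inferInstance
    obtain ⟨A, hA⟩ := hφ.2 t
    set S := ∑ k ∈ Finset.range N, t.prod k
    have S0 : 0 ≤ S := Finset.sum_nonneg fun k _ => (t.prod_pos k).le
    have A0 : 0 ≤ A := (quot_nonneg M t φ (0, 0)).trans (hA ⟨_, rfl⟩)
    have hn : (1 : ℝ) ≤ n + 1 := by linarith [Nat.cast_nonneg (α := ℝ) n]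
    obtain ⟨α, x, h⟩ := hcon (n + 1) (n + 1 + A * S) hn (by positivity)
    refine h.not_ge ?_
    have hM := M.pos (len α)
    rcases le_or_gt N (len α) with hl | hl
    · refine (hN _ hl α x rfl).trans (mul_le_mul_of_nonneg_right ?_ (by positivity))
      exact le_add_of_nonneg_right (by positivity)
    · have e : quot M t φ (α, x) ≤ A := hA ⟨_, rfl⟩
      rw [quot, div_le_iff₀ (den_pos M t _)] at e
      have e2 : t.prod (len α) ≤ S :=
        Finset.single_le_sum (f := t.prod) (fun k _ => (t.prod_pos k).le) (Finset.mem_range.2 hl)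
      calc ‖mD α φ x‖ ≤ A * (S * M.M (len α)) := e.trans (by gcongr)
        _ = A * S * (1 * M.M (len α)) := by ring
        _ ≤ _ := by
          gcongr
          · linarith
          · exact one_le_pow₀ hn
  obtain ⟨k, hk, hP⟩ := extraction_forall_of_frequently hfreq
  let c : ℕ → ℕ := fun j => ((Finset.range (j + 1)).filter fun n => k n ≤ j).card
  have c_mono : Monotone c := fun i j hij => by
    refine Finset.card_le_card fun n hn => ?_
    simp only [Finset.mem_filter, Finset.mem_range] at hn ⊢
    omega
  have le_c : ∀ n, n ≤ c (k n) := fun n => by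
    refine (Finset.card_range n).symm.le.trans (Finset.card_le_card fun i hi => ?_)
    have h1 := hk (Finset.mem_range.1 hi)
    have h2 := hk.id_le i
    simp only [Finset.mem_filter, Finset.mem_range, id] at h2 ⊢
    omega
  have c_le : ∀ n j, j < k n → c j ≤ n := fun n j hj => by
    refine (Finset.card_le_card fun i hi => ?_).trans (Finset.card_range n).le
    simp only [Finset.mem_filter, Finset.mem_range] at hi ⊢
    exact hk.lt_iff_lt.1 (hi.2.trans_lt hj)
  have c_top : Tendsto c atTop atTop :=
    tendsto_atTop_atTop.2 fun n => ⟨k n, fun j hj => (le_c n).trans (c_mono hj)⟩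
  let t : IncSeq := ⟨fun j => (c j : ℝ) + 1, fun j => by positivity,
    fun i j h => by simpa using c_mono h,
    tendsto_atTop_add_const_right _ _ (tendsto_natCast_atTop_atTop.comp c_top)⟩
  obtain ⟨A, hA⟩ := hφ.2 t
  obtain ⟨n, hn⟩ := exists_nat_ge A
  obtain ⟨α, x, hl, h⟩ := hP n
  have e : quot M t φ (α, x) ≤ A := hA ⟨_, rfl⟩
  rw [quot, div_le_iff₀ (den_pos M t _), hl] at e
  have hT : t.prod (k n) ≤ ((n : ℝ) + 1) ^ k n := by
    refine (Finset.prod_le_prod (fun j _ => (t.2.1 j).le) fun j hj => ?_).trans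
      (by simp : ∏ _j ∈ Finset.range (k n), ((n : ℝ) + 1) ≤ _)
    have := c_le n j (Finset.mem_range.1 hj)
    simpa [t] using this
  refine (h.trans_le e).not_ge ?_
  have := M.pos (k n)
  have := t.prod_pos (k n)
  gcongr
  linarith

theorem IsCutoff.mul_mem_testSpace {M : WeightSequence} {r L : ℝ} {χ φ : Rd d → ℂ}
    (hχ : IsCutoff M r L χ) (hφ : φ ∈ boundedSpace M d) : χ * φ ∈ testSpace M d := by
  obtain ⟨h, C, h1, C0, H⟩ := exists_pow_bound hφ
  refine ⟨hχ.smooth.mul hφ.1, hχ.hasCompactSupport.mul_right, 2 * (2 * h), 2 ^ d * C,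
    by positivity, by positivity, fun α x => ?_⟩
  refine (norm_mD_mul_le α hχ.smooth hφ.1 x
    (B := 2 ^ d * C * ((2 * h) ^ len α * M.M (len α))) fun β γ hl => ?_).trans
    (le_of_eq (by rw [mul_pow 2 (2 * h)]; ring))
  have := (M.pos (len β)).le
  have := (M.pos (len γ)).le
  have hM := M.mul_le_of_add_eq hl
  calc _ ≤ 2 ^ d * (2 ^ len β * M.M (len β)) * (C * (h ^ len γ * M.M (len γ))) :=
        mul_le_mul (hχ.bound β x) (H γ x) (norm_nonneg _) (by positivity)
    _ ≤ 2 ^ d * ((2 * h) ^ len β * M.M (len β)) * (C * ((2 * h) ^ len γ * M.M (len γ))) := by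
        gcongr
        · linarith
        · linarith
    _ = 2 ^ d * C * ((2 * h) ^ len α * (M.M (len β) * M.M (len γ))) := by
        rw [← hl, pow_add]
        ring
    _ ≤ _ := by gcongr

/-- Multiplication by a cutoff function, as a linear map into the test functions. -/
def IsCutoff.mulLeft {M : WeightSequence} {r L : ℝ} {χ : Rd d → ℂ} (hχ : IsCutoff M r L χ) :
    boundedSpace M d →ₗ[ℂ] testSpace M d where
  toFun φ := ⟨χ * φ.1, hχ.mul_mem_testSpace φ.2⟩
  map_add' φ ψ := Subtype.ext (mul_add χ φ.1 ψ.1)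
  map_smul' c φ := Subtype.ext (mul_smul_comm c χ φ.1)

theorem IsCutoff.mul_eventuallyEq {M : WeightSequence} {r L : ℝ} {χ : Rd d → ℂ}
    (hχ : IsCutoff M r L χ) (φ : Rd d → ℂ) {x : Rd d} (hx : ‖x‖ < r) : χ * φ =ᶠ[𝓝 x] φ := by
  filter_upwards [continuous_norm.continuousAt.eventually_lt_const hx] with y hy
  rw [Pi.mul_apply, hχ.eq_one y hy.le, one_mul]

/-! ### The seminorms -/

theorem quot_le_normSeminorm {M : WeightSequence} (t : IncSeq) (φ : boundedSpace M d)
    (p : (Fin d → ℕ) × Rd d) : quot M t φ.1 p ≤ normSeminorm M d t φ :=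
  le_ciSup (φ.2.2 t) p

theorem normSeminorm_le {M : WeightSequence} {t : IncSeq} {φ : boundedSpace M d} {B : ℝ}
    (h : ∀ α x, quot M t φ.1 (α, x) ≤ B) : normSeminorm M d t φ ≤ B :=
  ciSup_le fun p => h p.1 p.2

theorem le_weightedSeminorm {M : WeightSequence} (g : C₀(Rd d, ℂ)) (t : IncSeq)
    (φ : boundedSpace M d) (α : Fin d → ℕ) (x : Rd d) :
    ‖g x‖ * quot M t φ.1 (α, x) ≤ weightedSeminorm M d (g, t) φ :=
  le_ciSup (weighted_bdd M d g t φ) (α, x)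

theorem weightedSeminorm_le {M : WeightSequence} {g : C₀(Rd d, ℂ)} {t : IncSeq}
    {φ : boundedSpace M d} {B : ℝ} (h : ∀ α x, ‖g x‖ * quot M t φ.1 (α, x) ≤ B) :
    weightedSeminorm M d (g, t) φ ≤ B :=
  ciSup_le fun p => h p.1 p.2

theorem weightedSeminorm_le_normSeminorm {M : WeightSequence} (g : C₀(Rd d, ℂ)) (t : IncSeq)
    (φ : boundedSpace M d) : weightedSeminorm M d (g, t) φ ≤ ‖g.toBCF‖ * normSeminorm M d t φ :=
  weightedSeminorm_le fun α x => mul_le_mul (g.toBCF.norm_coe_le_norm x)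
    (quot_le_normSeminorm t φ (α, x)) (quot_nonneg M t _ _) (norm_nonneg _)

theorem normSeminorm_mono {M : WeightSequence} {s t : IncSeq} (h : ∀ j, s.1 j ≤ t.1 j)
    (φ : boundedSpace M d) : normSeminorm M d t φ ≤ normSeminorm M d s φ :=
  normSeminorm_le fun α x => (quot_le_quot h φ.1 (α, x)).trans (quot_le_normSeminorm s φ (α, x))

theorem IncSeq.exists_forall_le (s : Finset IncSeq) :
    ∃ t : IncSeq, ∀ u ∈ s, ∀ j, t.1 j ≤ u.1 j := by
  classical
  induction s using Finset.induction_on with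
  | empty => exact ⟨Classical.arbitrary _, by simp⟩
  | insert u s _ ih =>
    obtain ⟨t, ht⟩ := ih
    refine ⟨u.min t, fun v hv j => ?_⟩
    rcases Finset.mem_insert.1 hv with rfl | hv
    · exact min_le_left _ _
    · exact (min_le_right _ _).trans (ht v hv j)

/-- A function in `𝒞₀` that tends to `0` as slowly as prescribed: it is at least `2⁻ᵏ` on the ball
of radius `L k`, for every `k`. -/
theorem exists_zeroAtInfty_ge (d : ℕ) (L : ℕ → ℝ) :
    ∃ g : C₀(Rd d, ℂ), ∀ k x, ‖x‖ ≤ L k → (1 / 2 : ℝ) ^ k ≤ ‖g x‖ := by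
  let b : ℕ → Rd d → ℝ := fun k x => max 0 (min 1 (L k + 1 - ‖x‖))
  have b0 : ∀ k x, 0 ≤ b k x := fun k x => le_max_left _ _
  have b1 : ∀ k x, b k x ≤ 1 := fun k x => max_le zero_le_one (min_le_left _ _)
  have bc : ∀ k, Continuous (b k) := fun k => by fun_prop
  have hp : ∀ k : ℕ, (0 : ℝ) ≤ (1 / 2) ^ k := fun k => by positivity
  have hle : ∀ k x, (1 / 2 : ℝ) ^ k * b k x ≤ (1 / 2) ^ k := fun k x =>
    mul_le_of_le_one_right (hp k) (b1 k x)
  have hn : ∀ k x, ‖(1 / 2 : ℝ) ^ k * b k x‖ ≤ (1 / 2) ^ k := fun k x => by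
    rw [Real.norm_of_nonneg (mul_nonneg (hp k) (b0 k x))]
    exact hle k x
  have hs := summable_geometric_two
  have hcont : Continuous fun x => ∑' k, (1 / 2 : ℝ) ^ k * b k x :=
    continuous_tsum (fun k => continuous_const.mul (bc k)) hs hn
  have hzero : Tendsto (fun x => ∑' k, (1 / 2 : ℝ) ^ k * b k x) (cocompact (Rd d)) (𝓝 0) := by
    have h := tendsto_tsum_of_dominated_convergence (𝓕 := cocompact (Rd d))
      (f := fun x k => (1 / 2 : ℝ) ^ k * b k x) (g := fun _ => 0) hs (fun k => by
        refine tendsto_const_nhds.congr' ?_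
        filter_upwards [tendsto_norm_cocompact_atTop.eventually_ge_atTop (L k + 1)] with x hx
        have : b k x = 0 := max_eq_left ((min_le_right _ _).trans (by linarith))
        rw [this, mul_zero]) (Eventually.of_forall fun x k => hn k x)
    simpa using h
  refine ⟨⟨⟨fun x => ((∑' k, (1 / 2 : ℝ) ^ k * b k x : ℝ) : ℂ),
    Complex.continuous_ofReal.comp hcont⟩, ?_⟩, fun k x hx => ?_⟩
  · exact Complex.ofReal_zero ▸ (Complex.continuous_ofReal.tendsto 0).comp hzero
  · have hb : b k x = 1 := by
      simp only [b]
      rw [min_eq_left (by linarith), max_eq_right zero_le_one]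
    have e := (Summable.of_norm_bounded hs fun k => hn k x).le_tsum k
      fun j _ => mul_nonneg (hp j) (b0 j x)
    rw [hb, mul_one] at e
    refine e.trans ((le_abs_self _).trans (le_of_eq ?_))
    exact (Complex.norm_real _).symm

/-! ### Functionals on the test functions -/

/-- The norm `‖·‖_{(t_j)}` on the test functions. -/
def testSeminorm (M : WeightSequence) (d : ℕ) (t : IncSeq) : Seminorm ℂ (testSpace M d) :=
  (normSeminorm M d t).comp (Submodule.inclusion (testSpace_le_boundedSpace M d))

theorem quot_le_testSeminorm {M : WeightSequence} (t : IncSeq) (φ : testSpace M d)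
    (p : (Fin d → ℕ) × Rd d) : quot M t φ.1 p ≤ testSeminorm M d t φ :=
  quot_le_normSeminorm t (Submodule.inclusion (testSpace_le_boundedSpace M d) φ) p

theorem testSeminorm_le {M : WeightSequence} {t : IncSeq} {φ : testSpace M d} {B : ℝ}
    (h : ∀ α x, quot M t φ.1 (α, x) ≤ B) : testSeminorm M d t φ ≤ B :=
  normSeminorm_le (φ := Submodule.inclusion (testSpace_le_boundedSpace M d) φ) h

/-- The norm of a sum of functions with disjoint supports is the maximum of their norms. -/
theorem testSeminorm_add_le {M : WeightSequence} {t : IncSeq} {φ ψ : testSpace M d} {R B : ℝ}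
    (hφ : ∀ x, R ≤ ‖x‖ → φ.1 x = 0) (hψ : ∀ x, ‖x‖ < R + 1 → ψ.1 x = 0)
    (bφ : testSeminorm M d t φ ≤ B) (bψ : testSeminorm M d t ψ ≤ B) :
    testSeminorm M d t (φ + ψ) ≤ B := by
  refine testSeminorm_le fun α x => ?_
  rcases lt_or_ge ‖x‖ (R + 1) with hx | hx
  · refine le_trans (le_of_eq ?_) ((quot_le_testSeminorm t φ (α, x)).trans bφ)
    refine quot_congr M t α ?_
    filter_upwards [continuous_norm.continuousAt.eventually_lt_const hx] with y hy
    simp [hψ y hy]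
  · refine le_trans (le_of_eq ?_) ((quot_le_testSeminorm t ψ (α, x)).trans bψ)
    refine quot_congr M t α ?_
    filter_upwards [continuous_norm.continuousAt.eventually_const_lt
      (show R < ‖x‖ by linarith)] with y hy
    simp [hφ y hy.le]

/-- A functional that is continuous for a norm `‖·‖_{(t_j)}` is small at infinity. Otherwise it
takes, for some `ε > 0`, the value `1` at functions of norm at most `1 / ε` that vanish on arbitrarily
large balls. A sum of `n` such functions with disjoint supports still has norm at
most `1 / ε`, but the functional takes the value `n` at it. -/
theorem exists_norm_apply_le_of_eq_zero_on_ball {M : WeightSequence} {T : testSpace M d →ₗ[ℂ] ℂ}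
    {C : ℝ} {t : IncSeq} (hT : ∀ φ, ‖T φ‖ ≤ C * testSeminorm M d t φ) {ε : ℝ} (hε : 0 < ε) :
    ∃ R : ℝ, ∀ φ : testSpace M d, (∀ x, ‖x‖ < R → φ.1 x = 0) →
      ‖T φ‖ ≤ ε * testSeminorm M d t φ := by
  by_contra! hcon
  have h1 : ∀ R : ℝ, ∃ φ : testSpace M d, (∀ x, ‖x‖ < R → φ.1 x = 0) ∧ T φ = 1 ∧
      testSeminorm M d t φ ≤ ε⁻¹ := fun R => by
    obtain ⟨φ, hφ, hlt⟩ := hcon R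
    have hpos : 0 < ‖T φ‖ := (mul_nonneg hε.le (apply_nonneg _ _)).trans_lt hlt
    refine ⟨(T φ)⁻¹ • φ, fun x hx => by simp [hφ x hx], ?_, ?_⟩
    · rw [map_smul, smul_eq_mul, inv_mul_cancel₀ (norm_pos_iff.1 hpos)]
    · rw [map_smul_eq_mul, norm_inv, inv_mul_le_iff₀ hpos, ← div_eq_mul_inv, le_div_iff₀ hε,
        mul_comm]
      exact hlt.le
  have h2 : ∀ n : ℕ, ∃ φ : testSpace M d, T φ = n ∧ testSeminorm M d t φ ≤ ε⁻¹ := fun n => by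
    induction n with
    | zero => exact ⟨0, by simp, by simpa using hε.le⟩
    | succ n ih =>
      obtain ⟨φ, hφ, bφ⟩ := ih
      obtain ⟨R, hR⟩ := φ.2.2.1.isCompact.isBounded.subset_closedBall 0
      have hR' : ∀ x, R + 1 ≤ ‖x‖ → φ.1 x = 0 := fun x hx => by
        by_contra h
        have := hR (subset_tsupport _ (Function.mem_support.2 h))
        rw [mem_closedBall_zero_iff] at this
        linarith
      obtain ⟨ψ, hψ, hTψ, bψ⟩ := h1 (R + 1 + 1)
      exact ⟨φ + ψ, by rw [map_add, hφ, hTψ]; simp, testSeminorm_add_le hR' hψ bφ bψ⟩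
  obtain ⟨n, hn⟩ := exists_nat_gt (|C| * ε⁻¹)
  obtain ⟨φ, hφ, bφ⟩ := h2 n
  have e := hT φ
  rw [hφ, Complex.norm_natCast] at e
  have e2 : C * testSeminorm M d t φ ≤ |C| * ε⁻¹ :=
    mul_le_mul (le_abs_self C) bφ (apply_nonneg _ _) (abs_nonneg C)
  linarith

/-- Multiplication by a function `χ` that vanishes where `|g| < η` maps the weaker topology to the
stronger one: on the support of `χ`, the derivatives of `φ` are at most `η⁻¹` times the weighted
ones. -/
theorem exists_testSeminorm_mul_le (M : WeightSequence) (d : ℕ) (t : IncSeq) :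
    ∃ K : ℝ, 0 < K ∧ ∀ (χ : Rd d → ℂ) (φ : boundedSpace M d) (ψ : testSpace M d)
      (g : C₀(Rd d, ℂ)) (c η L : ℝ), ContDiff ℝ ∞ χ → ψ.1 = χ * φ.1 → 0 ≤ c → 0 < η →
      (∀ β x, ‖mD β χ x‖ ≤ c * (2 ^ len β * M.M (len β))) → (∀ x, L < ‖x‖ → χ x = 0) →
      (∀ x, ‖x‖ ≤ L → η ≤ ‖g x‖) →
      testSeminorm M d t ψ ≤ K * c * (weightedSeminorm M d (g, t.half) φ / η) := by
  obtain ⟨K, K0, hK⟩ := exists_quot_mul_le M d t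
  refine ⟨K, K0, fun χ φ ψ g c η L hχ hψ hc hη hb h0 hg => testSeminorm_le fun α x => ?_⟩
  have hp : 0 ≤ weightedSeminorm M d (g, t.half) φ / η := div_nonneg (apply_nonneg _ _) hη.le
  rw [hψ]
  rcases lt_or_ge L ‖x‖ with hx | hx
  · rw [quot_eq_zero_of_eventuallyEq]
    · positivity
    · filter_upwards [continuous_norm.continuousAt.eventually_const_lt hx] with y hy
      simp [h0 y hy]
  · refine hK χ φ.1 hχ φ.2.1 x c _ hc hp (fun β => hb β x) (fun γ => ?_) α
    rw [le_div_iff₀ hη, mul_comm]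
    exact (mul_le_mul_of_nonneg_right (hg x hx) (quot_nonneg M _ _ _)).trans
      (le_weightedSeminorm g t.half φ γ x)

/-- The test functions `χ_n φ` converge to `φ` for the seminorms `p_{g,(t_j)}`, if `χ_n` is `1` on
the ball of radius `n`: the differences are bounded for the norms `‖·‖_{(t_j)}` and vanish
where `g` is not small. -/
theorem tendsto_mulLeft {M : WeightSequence} {L : ℕ → ℝ} {χ : ℕ → Rd d → ℂ}
    (hχ : ∀ n : ℕ, IsCutoff M n (L n) (χ n)) (φ : DInfWeighted M d) :
    Tendsto (fun n => DInf.toWeighted M d (testToDInf M d ((hχ n).mulLeft φ))) atTop (𝓝 φ) := by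
  refine ((DInfWeighted.withSeminorms M d).tendsto_nhds_atTop _ φ).2 ?_
  rintro ⟨g, t⟩ ε hε
  obtain ⟨K, K0, hK⟩ := exists_quot_mul_le M d t
  let φ' : boundedSpace M d := φ
  set B := K * 2 ^ d * normSeminorm M d t.half φ' + normSeminorm M d t φ'
  have B0 : 0 ≤ B := by positivity
  have hg : ∀ᶠ x in cocompact (Rd d), ‖g x‖ < ε / (2 * (B + 1)) := by
    have := (zero_at_infty g).norm
    rw [norm_zero] at this
    exact this.eventually_lt_const (by positivity)
  rw [← Metric.cobounded_eq_cocompact, (hasBasis_cobounded_norm).eventually_iff] at hg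
  obtain ⟨R, -, hR⟩ := hg
  obtain ⟨n, hn⟩ := exists_nat_ge R
  refine ⟨n, fun m hm => ?_⟩
  have hle : weightedSeminorm M d (g, t)
      ((⟨χ m * φ'.1, testSpace_le_boundedSpace M d ((hχ m).mul_mem_testSpace φ'.2)⟩ :
        boundedSpace M d) - φ') ≤ ε / 2 := by
    refine weightedSeminorm_le fun α x => ?_
    rcases lt_or_ge ‖x‖ m with hx | hx
    · rw [quot_eq_zero_of_eventuallyEq, mul_zero]
      · positivity
      · filter_upwards [(hχ m).mul_eventuallyEq φ'.1 hx] with y hy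
        simpa [sub_eq_zero] using hy
    · have h1 : ‖g x‖ ≤ ε / (2 * (B + 1)) :=
        (hR (show R ≤ ‖x‖ from hn.trans ((Nat.cast_le.2 hm).trans hx))).le
      have h2 : quot M t (χ m * φ'.1 - φ'.1) (α, x) ≤ B := by
        have e1 := hK (χ m) φ'.1 (hχ m).smooth φ'.2.1 x (2 ^ d) (normSeminorm M d t.half φ')
          (by positivity) (apply_nonneg _ _) (fun β => (hχ m).bound β x)
          (fun γ => quot_le_normSeminorm t.half φ' (γ, x)) α
        have e2 := quot_le_normSeminorm t φ' (α, x)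
        refine le_trans ?_ (add_le_add e1 e2)
        have e3 : mD α (χ m * φ'.1 - φ'.1) = mD α (χ m * φ'.1) - mD α φ'.1 :=
          mD_sub α ((hχ m).smooth.mul φ'.2.1) φ'.2.1
        simp only [quot]
        rw [e3, ← add_div]
        exact div_le_div_of_nonneg_right (norm_sub_le _ _) (den_pos M t _).le
      calc _ ≤ ε / (2 * (B + 1)) * B := mul_le_mul h1 h2 (quot_nonneg M t _ _) (by positivity)
        _ ≤ ε / (2 * (B + 1)) * (B + 1) := by gcongr; linarith
        _ = ε / 2 := by field_simp
  exact hle.trans_lt (half_lt_self hε)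

/-- The extension theorem: a functional on the test functions that is continuous for
a norm `‖·‖_{(t_j)}` extends continuously to `DInfWeighted M d`. With cutoff functions `χ_n` for
sufficiently large balls, `T` is at most `4⁻ⁿ ‖·‖_{(t_j)}` on the range of multiplication by
`χ_{n+1} - χ_n`. If `g ∈ 𝒞₀` is at least `2⁻ⁿ` on the support of `χ_{n+1} - χ_n`, then
`|T(χ_{n+1} φ) - T(χ_n φ)|` is at most a constant times `2⁻ⁿ p_{g,(t_j/2)}(φ)`, so that
`lim T(χ_n φ)` exists and is at most a constant times `p_{g,(t_j/2)}(φ)`. -/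
theorem exists_extension {M : WeightSequence} {T : testSpace M d →ₗ[ℂ] ℂ} {C : ℝ} {t : IncSeq}
    (hT : ∀ φ, ‖T φ‖ ≤ C * testSeminorm M d t φ) : ∃ S : DualWeighted M d, S.onTest = T := by
  choose ρ hρ using fun n : ℕ => exists_norm_apply_le_of_eq_zero_on_ball hT
    (show (0 : ℝ) < (1 / 4) ^ n by positivity)
  -- Radii that exhaust the space, increase, and are at least `ρ n`, so that both `χ (n + 1)` and `χ n`
  -- are `1` on the ball of radius `ρ n`.
  let r : ℕ → ℝ := fun n => n + ∑ i ∈ Finset.range (n + 1), |ρ i|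
  have r0 : ∀ n, 0 ≤ r n := fun n =>
    add_nonneg (Nat.cast_nonneg n) (Finset.sum_nonneg fun i _ => abs_nonneg _)
  have ρ_le : ∀ n, ρ n ≤ r n := fun n =>
    (le_abs_self _).trans ((Finset.single_le_sum (f := fun i => |ρ i|) (fun i _ => abs_nonneg _)
      (Finset.self_mem_range_succ n)).trans (le_add_of_nonneg_left (Nat.cast_nonneg n)))
  have r_le : ∀ n, r n ≤ r (n + 1) := fun n => by
    have : r (n + 1) = r n + 1 + |ρ (n + 1)| := by
      simp only [r]
      rw [Finset.sum_range_succ _ (n + 1)]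
      push_cast
      ring
    have := abs_nonneg (ρ (n + 1))
    linarith
  have n_le : ∀ n : ℕ, (n : ℝ) ≤ r n := fun n =>
    le_add_of_nonneg_right (Finset.sum_nonneg fun i _ => abs_nonneg _)
  choose L χ hχ using fun n => exists_isCutoff M d (r0 n)
  obtain ⟨g, hg⟩ := exists_zeroAtInfty_ge d fun n => max (L n) (L (n + 1))
  obtain ⟨K, K0, hK⟩ := exists_testSeminorm_mul_le M d t
  let p : boundedSpace M d → ℝ := weightedSeminorm M d (g, t.half)
  have hdist : ∀ φ n, dist (T ((hχ n).mulLeft φ)) (T ((hχ (n + 1)).mulLeft φ)) ≤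
      K * (2 * 2 ^ d) * p φ * (1 / 2) ^ n := fun φ n => by
    rw [dist_comm, dist_eq_norm, ← map_sub]
    have hs := (hχ n).smooth
    have hs' := (hχ (n + 1)).smooth
    have e1 := hρ n ((hχ (n + 1)).mulLeft φ - (hχ n).mulLeft φ) fun x hx => by
      have a1 := (hχ n).eq_one x (hx.le.trans (ρ_le n))
      have a2 := (hχ (n + 1)).eq_one x (hx.le.trans ((ρ_le n).trans (r_le n)))
      simp [IsCutoff.mulLeft, a1, a2]
    have e2 := hK (χ (n + 1) - χ n) φ ((hχ (n + 1)).mulLeft φ - (hχ n).mulLeft φ) g (2 * 2 ^ d)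
      ((1 / 2) ^ n) (max (L n) (L (n + 1))) (hs'.sub hs)
      (sub_mul (χ (n + 1)) (χ n) φ.1).symm (by positivity) (by positivity)
      (fun β x => by
        rw [mD_sub β hs' hs]
        refine (norm_sub_le _ _).trans ((add_le_add ((hχ (n + 1)).bound β x)
          ((hχ n).bound β x)).trans (le_of_eq (by ring))))
      (fun x hx => by
        have hx' := max_lt_iff.1 hx
        simp [(hχ n).eq_zero x hx'.1.le, (hχ (n + 1)).eq_zero x hx'.2.le])
      (hg n)
    refine e1.trans ((mul_le_mul_of_nonneg_left e2 (by positivity)).trans (le_of_eq ?_))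
    rw [show (1 / 4 : ℝ) = 1 / 2 * (1 / 2) by norm_num, mul_pow]
    field_simp
    rfl
  have hzero : ∀ φ, ‖T ((hχ 0).mulLeft φ)‖ ≤ |C| * (K * 2 ^ d) * p φ := fun φ => by
    have e := hK (χ 0) φ ((hχ 0).mulLeft φ) g (2 ^ d) 1 (L 0) (hχ 0).smooth rfl (by positivity)
      one_pos (hχ 0).bound (fun x hx => (hχ 0).eq_zero x hx.le)
      (fun x hx => by simpa using hg 0 x (hx.trans (le_max_left _ _)))
    refine (hT _).trans ((mul_le_mul (le_abs_self C) e (apply_nonneg _ _) (abs_nonneg C)).trans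
      (le_of_eq ?_))
    rw [div_one, mul_assoc |C|]
  choose S hS using fun φ : boundedSpace M d => cauchySeq_tendsto_of_complete
    (cauchySeq_of_le_geometric (1 / 2) _ one_half_lt_one (hdist φ))
  let S' : boundedSpace M d →ₗ[ℂ] ℂ :=
    linearMapOfTendsto S (fun n => T ∘ₗ (hχ n).mulLeft) (tendsto_pi_nhds.2 hS) (l := atTop)
  have S_le : ∀ φ, ‖S' φ‖ ≤ (|C| * (K * 2 ^ d) + K * (2 * 2 ^ d) * 2) * p φ := fun φ => by
    have e1 := dist_le_of_le_geometric_of_tendsto₀ (1 / 2) _ one_half_lt_one (hdist φ) (hS φ)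
    have e2 := hzero φ
    rw [dist_eq_norm] at e1
    have e3 := norm_le_norm_add_norm_sub (T ((hχ 0).mulLeft φ)) (S φ)
    have e4 : K * (2 * 2 ^ d) * p φ / (1 - 1 / 2) = K * (2 * 2 ^ d) * 2 * p φ := by ring
    rw [e4] at e1
    change ‖S φ‖ ≤ _
    linarith
  let S'' : DInfWeighted M d →ₗ[ℂ] ℂ := S'
  have hcont : Continuous S'' := by
    refine WithSeminorms.continuous_normedSpace_rng ℂ (DInfWeighted.withSeminorms M d) S''
      ⟨{(g, t.half)}, ⟨|C| * (K * 2 ^ d) + K * (2 * 2 ^ d) * 2, by positivity⟩, fun φ => ?_⟩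
    rw [Finset.sup_singleton]
    exact S_le φ
  refine ⟨⟨S'', hcont⟩, LinearMap.ext fun φ => ?_⟩
  -- For large `n`, the function `χ_n` is `1` on the support of `φ`.
  obtain ⟨R, hR⟩ := φ.2.2.1.isCompact.isBounded.subset_closedBall 0
  obtain ⟨N, hN⟩ := exists_nat_ge R
  refine tendsto_nhds_unique (hS (Submodule.inclusion (testSpace_le_boundedSpace M d) φ))
    (tendsto_const_nhds.congr' ?_)
  filter_upwards [eventually_ge_atTop N] with n hn
  congr 1
  refine Subtype.ext (funext fun x => ?_)
  change φ.1 x = χ n x * φ.1 x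
  by_cases hx : φ.1 x = 0
  · rw [hx, mul_zero]
  · have := hR (subset_tsupport _ (Function.mem_support.2 hx))
    rw [mem_closedBall_zero_iff] at this
    rw [(hχ n).eq_one x (this.trans (hN.trans ((Nat.cast_le.2 hn).trans (n_le n)))), one_mul]

/-! ### The two duals -/

theorem denseRange_testToBDot (M : WeightSequence) (d : ℕ) : DenseRange (testToBDot M d) := by
  intro φ
  rw [Topology.IsInducing.subtypeVal.closure_eq_preimage_closure_image, Set.mem_preimage,
    ← Set.range_comp]
  exact φ.2

theorem DualL1.onTest_injective (M : WeightSequence) (d : ℕ) :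
    Function.Injective (DualL1.onTest (M := M) (d := d)) := fun T S h =>
  ContinuousLinearMap.ext fun φ => congrFun ((denseRange_testToBDot M d).equalizer T.continuous
    S.continuous (funext fun ψ => LinearMap.congr_fun h ψ)) φ

theorem DualWeighted.onTest_injective (M : WeightSequence) (d : ℕ) :
    Function.Injective (DualWeighted.onTest (M := M) (d := d)) := fun T S h => by
  choose L χ hχ using fun n : ℕ => exists_isCutoff M d (Nat.cast_nonneg (α := ℝ) n)
  refine ContinuousLinearMap.ext fun φ => ?_
  have lim := tendsto_mulLeft hχ φ
  refine tendsto_nhds_unique ((T.continuous.tendsto φ).comp lim)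
    (((S.continuous.tendsto φ).comp lim).congr fun n => ?_)
  exact (LinearMap.congr_fun h ((hχ n).mulLeft φ)).symm

theorem DualL1.exists_norm_onTest_le {M : WeightSequence} (T : DualL1 M d) :
    ∃ (C : ℝ) (t : IncSeq), ∀ φ, ‖T.onTest φ‖ ≤ C * testSeminorm M d t φ := by
  have hw : WithSeminorms ((DInf.seminorms M d).comp (BDot M d).subtype) :=
    Topology.IsInducing.subtypeVal.withSeminorms (f := (BDot M d).subtype) (DInf.withSeminorms M d)
  obtain ⟨s, C, -, h⟩ := Seminorm.bound_of_continuous hw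
    ((_root_.normSeminorm ℂ ℂ).comp T.toLinearMap) T.continuous.norm
  obtain ⟨t, ht⟩ := IncSeq.exists_forall_le s
  refine ⟨C, t, fun φ => (h (testToBDot M d φ)).trans ?_⟩
  refine mul_le_mul_of_nonneg_left ?_ C.2
  refine Seminorm.finset_sup_apply_le (apply_nonneg _ _) fun u hu => ?_
  exact normSeminorm_mono (ht u hu) (Submodule.inclusion (testSpace_le_boundedSpace M d) φ)

/-- The identity map from the closure of the test functions to `DInfWeighted M d`, which is continuous
because `p_{g,(t_j)} ≤ sup |g| · ‖·‖_{(t_j)}`. -/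
def BDot.toWeighted (M : WeightSequence) (d : ℕ) : BDot M d →L[ℂ] DInfWeighted M d where
  toLinearMap := DInf.toWeighted M d ∘ₗ (BDot M d).subtype
  cont := by
    have h : Continuous (DInf.toWeighted M d) := by
      refine WithSeminorms.continuous_of_isBounded (DInf.withSeminorms M d)
        (DInfWeighted.withSeminorms M d) _ fun i => ⟨{i.2}, ‖i.1.toBCF‖₊, fun φ => ?_⟩
      rw [Finset.sup_singleton]
      exact weightedSeminorm_le_normSeminorm i.1 i.2 φ
    exact h.comp continuous_subtype_val

theorem bijective_precomp_toWeighted (M : WeightSequence) (d : ℕ) :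
    Function.Bijective (ContinuousLinearMap.precomp ℂ (BDot.toWeighted M d) :
      DualWeighted M d →L[ℂ] DualL1 M d) := by
  refine ⟨fun T S h => DualWeighted.onTest_injective M d ?_, fun T => ?_⟩
  · exact LinearMap.ext fun φ => DFunLike.congr_fun h (testToBDot M d φ)
  · obtain ⟨C, t, hT⟩ := DualL1.exists_norm_onTest_le T
    obtain ⟨S, hS⟩ := exists_extension hT
    exact ⟨S, DualL1.onTest_injective M d hS⟩

end Roumieu

end

theorem proposition25 (M : Roumieu.WeightSequence) (d : ℕ) :
    Function.Injective (Roumieu.DualL1.onTest (M := M) (d := d)) ∧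
    Function.Injective (Roumieu.DualWeighted.onTest (M := M) (d := d)) ∧
    Set.range (Roumieu.DualL1.onTest (M := M) (d := d)) =
      Set.range (Roumieu.DualWeighted.onTest (M := M) (d := d)) ∧
    ∃ ι : Roumieu.DualWeighted M d →L[ℂ] Roumieu.DualL1 M d,
      Function.Bijective ι ∧
      (∀ (T : Roumieu.DualWeighted M d) (φ : Roumieu.BDot M d),
        ι T φ = T (Roumieu.DInf.toWeighted M d (φ : Roumieu.DInf M d))) := by
  refine ⟨Roumieu.DualL1.onTest_injective M d, Roumieu.DualWeighted.onTest_injective M d, ?_,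
    ContinuousLinearMap.precomp ℂ (Roumieu.BDot.toWeighted M d),
    Roumieu.bijective_precomp_toWeighted M d, fun T φ => rfl⟩
  exact ((Roumieu.bijective_precomp_toWeighted M d).2.range_comp
    (Roumieu.DualL1.onTest (M := M) (d := d))).symm
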